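/- A planar map is a finite connected graph (loops and multiple edges allowed) embedded in the plane with no edge-crossings. Its outer face is the unbounded face. A bipolar map $M$ is a planar map with two distinct distinguished vertices $s$ (the source) and $t$ (the sink), both on the outer face. A bipolar orientation of $M$ is an acyclic orientation of its edges such that $s$ is the only vertex with no ingoing edge and $t$ is the only vertex with no outgoing edge. Let $\hat M$ be the rooted map obtained from $M$ by adding, in the outer face, a root edge from $s$ to $t$. A map is separable if deleting some vertex disconnects it, that is, if its edges can be partitioned into two nonempty classes having only that vertex in common (in particular, a loop together with any other edge makes a map separable). The bipolar map $M$ is called series-parallel if $\hat M$ is non-separable and does not contain the complete graph $K_4$ as a minor. **Lemma.** A bipolar map $M$ admits a unique bipolar orientation (that is, exactly one) if and only if it is series-parallel. -/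

import Mathlib

open scoped Graph

/-- The Euclidean plane `ℝ²`. -/
abbrev Plane : Type := EuclideanSpace ℝ (Fin 2)

/-! ### Plane maps (loops and multiple edges are allowed) -/

/-- A planar map: a finite connected multigraph embedded in the plane without edge-crossings.
The vertices are points of the plane. Each edge `e` is drawn as the curve
`curve e : [0, 1] → ℝ²` (a simple arc, or a simple closed curve if `e` is a loop). -/
structure PlanarMap (β : Type*) where
  /-- The underlying multigraph. -/
  graph : Graph Plane β
  finite_vertexSet : V(graph).Finite
  finite_edgeSet : E(graph).Finite
  connected : graph.toSimpleGraph.Connected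
  /-- The curve along which an edge is drawn (irrelevant outside the edge set). -/
  curve : β → C(unitInterval, Plane)
  /-- The endpoints of the curve are the ends of the edge. -/
  isLink_curve : ∀ e ∈ E(graph), graph.IsLink e (curve e 0) (curve e 1)
  /-- The open edge has no self-crossing. -/
  injOn_curve : ∀ e ∈ E(graph), Set.InjOn (curve e) (Set.Ioo 0 1)
  /-- The open edge contains no vertex. -/
  curve_notMem : ∀ e ∈ E(graph), ∀ t ∈ Set.Ioo (0 : unitInterval) 1, curve e t ∉ V(graph)
  /-- Distinct open edges do not meet. -/
  disjoint_curve : ∀ e ∈ E(graph), ∀ f ∈ E(graph), e ≠ f →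
    Disjoint (curve e '' Set.Ioo 0 1) (curve f '' Set.Ioo 0 1)

namespace PlanarMap

variable {β : Type*} (M : PlanarMap β)

/-- The set of points of the plane that lie on a vertex or an edge of the map. -/
def drawing : Set Plane := V(M.graph) ∪ ⋃ e ∈ E(M.graph), Set.range (M.curve e)

/-- The outer face: the unbounded connected component of the complement of the drawing. -/
def outerFace : Set Plane :=
  {p | p ∈ M.drawingᶜ ∧ ¬ Bornology.IsBounded (connectedComponentIn M.drawingᶜ p)}

end PlanarMap

/-- A bipolar map: a planar map with two distinguished (distinct) vertices, the source and the
sink, both on the outer face. -/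
structure BipolarMap (β : Type*) extends PlanarMap β where
  source : Plane
  sink : Plane
  source_mem : source ∈ V(graph)
  sink_mem : sink ∈ V(graph)
  source_ne_sink : source ≠ sink
  source_outer : source ∈ closure toPlanarMap.outerFace
  sink_outer : sink ∈ closure toPlanarMap.outerFace

/-! ### Orientations -/

/-- An orientation of a multigraph: every edge is given exactly one of its directions.
`Arc e x y` means that the edge `e` goes from `x` to `y`. -/
@[ext]
structure GraphOrientation {α β : Type*} (G : Graph α β) where
  Arc : β → α → α → Prop
  isLink : ∀ e x y, Arc e x y → G.IsLink e x y
  arc_or_arc : ∀ e x y, G.IsLink e x y → Arc e x y ∨ Arc e y x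
  arc_unique : ∀ e x y x' y', Arc e x y → Arc e x' y' → x = x' ∧ y = y'

namespace GraphOrientation

variable {α β : Type*} {G : Graph α β} (O : GraphOrientation G)

/-- There is no directed cycle (a loop is a directed cycle of length one). -/
def Acyclic : Prop := ∀ x, ¬ Relation.TransGen (fun u v ↦ ∃ e, O.Arc e u v) x x

/-- A source is a vertex with no ingoing edge. -/
def IsSource (v : α) : Prop := v ∈ V(G) ∧ ∀ e u, ¬ O.Arc e u v

/-- A sink is a vertex with no outgoing edge. -/
def IsSink (v : α) : Prop := v ∈ V(G) ∧ ∀ e u, ¬ O.Arc e v u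

/-- A bipolar orientation with poles `s` and `t`: an acyclic orientation of which `s` is the unique
source and `t` is the unique sink. -/
def IsBipolar (s t : α) : Prop :=
  O.Acyclic ∧ (∀ v, O.IsSource v ↔ v = s) ∧ (∀ v, O.IsSink v ↔ v = t)

end GraphOrientation

/-! ### Separability and minors -/

/-- A connected multigraph is separable if deleting some vertex `v` disconnects it: the edges
fall into two nonempty classes that share no vertex other than `v`. As usual for maps, only the
point `v` is deleted, so that a loop at `v` together with any other edge gives a separable
multigraph. -/
def Graph.IsSeparable {α β : Type*} (G : Graph α β) : Prop :=
  ∃ v ∈ V(G), ∃ A B : Set β, A.Nonempty ∧ B.Nonempty ∧ Disjoint A B ∧ A ∪ B = E(G) ∧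
    ∀ e ∈ A, ∀ f ∈ B, ∀ w, G.Inc e w → G.Inc f w → w = v

/-- `H` is a minor of `G`: there are disjoint connected branch sets of vertices of `G`, indexed by
the vertices of `H`, such that adjacent vertices of `H` have branch sets joined by an edge. -/
def SimpleGraph.IsMinorOf {W V : Type*} (H : SimpleGraph W) (G : SimpleGraph V) : Prop :=
  ∃ B : W → Set V, (∀ w, (G.induce (B w)).Connected) ∧
    (∀ w w', w ≠ w' → Disjoint (B w) (B w')) ∧
    (∀ w w', H.Adj w w' → ∃ x ∈ B w, ∃ y ∈ B w', G.Adj x y)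

/-! ### Rooted maps and series-parallel bipolar maps -/

namespace BipolarMap

variable {β : Type*} (M : BipolarMap β)

/-- The multigraph underlying the rooted map obtained from `M` by adding a root edge, drawn in
the outer face, from the source to the sink. The root edge is `none`. (Separability and minors
depend on this multigraph only, not on the drawing of the root edge.) -/
def rootedGraph : Graph Plane (Option β) where
  vertexSet := V(M.graph)
  IsLink
    | none, x, y => (x = M.source ∧ y = M.sink) ∨ (x = M.sink ∧ y = M.source)
    | some e, x, y => M.graph.IsLink e x y
  isLink_symm := by
    rintro (_ | e) _
    · exact ⟨by tauto⟩
    · exact ⟨fun x y h ↦ h.symm⟩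
  eq_or_eq_of_isLink_of_isLink := by
    rintro (_ | e) x y v w h h'
    · dsimp only at h h'
      grind
    · exact h.left_eq_or_eq h'
  left_mem_of_isLink := by
    rintro (_ | e) x y h
    · rcases h with ⟨rfl, _⟩ | ⟨rfl, _⟩
      exacts [M.source_mem, M.sink_mem]
    · exact h.left_mem

/-- A bipolar map is series-parallel if the corresponding rooted map is non-separable and does not
contain `K₄` as a minor. -/
def IsSeriesParallel : Prop :=
  ¬ M.rootedGraph.IsSeparable ∧
    ¬ (SimpleGraph.completeGraph (Fin 4)).IsMinorOf M.rootedGraph.toSimpleGraph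

end BipolarMap

/-! ### Bipolar relations, `K₄` models and forks -/

open Relation

/-! The statement splits in two: the rooted graph is non-separable exactly when some bipolar
orientation exists, and once one exists, it is unique exactly when there is no `K₄` minor.
Acyclicity forces parallel edges to agree, so orientations can be replaced by relations on the
vertices (`isBipolar_iff`, `eq_of_rel_imp`).

Existence. If a vertex `v` cuts off a class of edges without the root edge, following an oriented
edge of that class upwards and downwards must reach `v` both ways, which closes a cycle
(`not_isSeparable`). Conversely, non-separability lets an ordering that starts as `s, t` grow by
ears until it contains all vertices (`exists_isBipolarRel`); every edge is then directed along the
ordering.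

Uniqueness (`isUniqueBipolar_iff`) is by induction on the number of vertices, through
`trivial_or_series_or_theta`. If only the poles remain, the orientation is forced and four branch
sets do not fit. A non-polar vertex with one arc in and one out can be replaced by a single arc,
which changes neither uniqueness nor the presence of a `K₄` minor. Otherwise take a fork with lowest
end `v`, then highest start `w`. Its two branches meet only at `v`, and an arc leaves the first
vertex `p` of one branch for a vertex that cannot reach `v`. Such a theta refutes both sides: it
contains a `K₄` minor together with `st`, and the part between `p` and `v` can be reversed. -/

/-- An acyclic relation with a unique source `s` and a unique sink `t`. -/
structure IsBipolarRel {V : Type*} (R : V → V → Prop) (s t : V) : Prop where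
  acyclic : ∀ x, ¬ TransGen R x x
  exists_in : ∀ x, x ≠ s → ∃ y, R y x
  exists_out : ∀ x, x ≠ t → ∃ y, R x y
  not_in : ∀ y, ¬ R y s
  not_out : ∀ y, ¬ R t y
  ne : s ≠ t

/-- The relation `R` is the only bipolar relation with the same underlying graph. -/
def IsUniqueBipolar {V : Type*} (R : V → V → Prop) (s t : V) : Prop :=
  ∀ R' : V → V → Prop, IsBipolarRel R' s t → (∀ x y, R' x y ∨ R' y x ↔ R x y ∨ R y x) →
    ∀ x y, R x y → R' x y

/-- The adjacency relation of the graph underlying `R`, with an additional edge `st`. -/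
def RootedAdj {V : Type*} (R : V → V → Prop) (s t : V) (x y : V) : Prop :=
  R x y ∨ R y x ∨ (x = s ∧ y = t) ∨ (x = t ∧ y = s)

/-- The sets `B i` are the branch sets of a `K₄` minor. -/
structure IsK4Model {V : Type*} (A : V → V → Prop) (B : Fin 4 → Set V) : Prop where
  nonempty : ∀ i, (B i).Nonempty
  connected : ∀ i, ∀ x ∈ B i, ∀ y ∈ B i, ReflTransGen (fun u w ↦ A u w ∧ w ∈ B i) x y
  inj : ∀ i j x, x ∈ B i → x ∈ B j → i = j
  adj : ∀ i j, i ≠ j → ∃ x ∈ B i, ∃ y ∈ B j, A x y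

/-- Two distinct arcs leaving `w` start directed paths to `v`. -/
def IsFork {V : Type*} (R : V → V → Prop) (w v : V) : Prop :=
  ∃ p q, p ≠ q ∧ R w p ∧ R w q ∧ ReflTransGen R p v ∧ ReflTransGen R q v

section

variable {V W : Type*} {R : V → V → Prop} {s t : V}

theorem RootedAdj.symm {x y : V} (h : RootedAdj R s t x y) : RootedAdj R s t y x := by
  unfold RootedAdj at *
  tauto

/-- A set is connected if all of its points are joined to a fixed one. -/
theorem reflTransGen_within_of_center {A : V → V → Prop} (hA : ∀ x y, A x y → A y x)
    {B : Set V} {c : V} (h : ∀ x ∈ B, ReflTransGen (fun u w ↦ A u w ∧ w ∈ B) x c) :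
    ∀ x ∈ B, ∀ y ∈ B, ReflTransGen (fun u w ↦ A u w ∧ w ∈ B) x y := by
  have key : ∀ x y, ReflTransGen (fun u w ↦ A u w ∧ w ∈ B) x y → x ∈ B →
      ReflTransGen (fun u w ↦ A u w ∧ w ∈ B) y x ∧ y ∈ B := by
    intro x y hxy hx
    induction hxy with
    | refl => exact ⟨.refl, hx⟩
    | tail _ hs ih => exact ⟨.head ⟨hA _ _ hs.1, ih.2⟩ ih.1, hs.2⟩
  exact fun x hx y hy ↦ (h x hx).trans (key y c (h y hy) hy).1

/-- A map that preserves adjacency up to contraction carries `K₄` models to `K₄` models. -/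
theorem IsK4Model.image {A : V → V → Prop} {A' : W → W → Prop} {B : Fin 4 → Set V}
    (hB : IsK4Model A B) (f : V → W) (hf : ∀ x y, A x y → f x = f y ∨ A' (f x) (f y))
    (hsep : ∀ i j x y, x ∈ B i → y ∈ B j → f x = f y → i = j) :
    IsK4Model A' fun i ↦ f '' B i where
  nonempty i := (hB.nonempty i).image f
  connected := by
    rintro i _ ⟨x, hx, rfl⟩ _ ⟨y, hy, rfl⟩
    refine ReflTransGen.lift' f ?_ _ _ (hB.connected i x hx y hy)
    rintro u w ⟨huw, hw⟩
    rcases hf u w huw with h | h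
    · simp only [Function.onFun, h]; exact .refl
    · exact .single ⟨h, w, hw, rfl⟩
  inj := by
    rintro i j _ ⟨x, hx, rfl⟩ ⟨y, hy, h⟩
    exact hsep i j x y hx hy h.symm
  adj i j hij := by
    obtain ⟨x, hx, y, hy, h⟩ := hB.adj i j hij
    refine ⟨f x, ⟨x, hx, rfl⟩, f y, ⟨y, hy, rfl⟩, ?_⟩
    exact (hf x y h).resolve_left fun h' ↦ hij (hsep i j x y hx hy h')

/-- By symmetry of the adjacency, one check for each of the six pairs of branch sets suffices. -/
theorem IsK4Model.of_pairs {A : V → V → Prop} (hA : ∀ x y, A x y → A y x) {C D E F : Set V}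
    (nC : C.Nonempty) (nD : D.Nonempty) (nE : E.Nonempty) (nF : F.Nonempty)
    (cC : ∀ x ∈ C, ∀ y ∈ C, ReflTransGen (fun u w ↦ A u w ∧ w ∈ C) x y)
    (cD : ∀ x ∈ D, ∀ y ∈ D, ReflTransGen (fun u w ↦ A u w ∧ w ∈ D) x y)
    (cE : ∀ x ∈ E, ∀ y ∈ E, ReflTransGen (fun u w ↦ A u w ∧ w ∈ E) x y)
    (cF : ∀ x ∈ F, ∀ y ∈ F, ReflTransGen (fun u w ↦ A u w ∧ w ∈ F) x y)
    (dCD : ∀ x ∈ C, x ∉ D) (dCE : ∀ x ∈ C, x ∉ E) (dCF : ∀ x ∈ C, x ∉ F)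
    (dDE : ∀ x ∈ D, x ∉ E) (dDF : ∀ x ∈ D, x ∉ F) (dEF : ∀ x ∈ E, x ∉ F)
    (aCD : ∃ x ∈ C, ∃ y ∈ D, A x y) (aCE : ∃ x ∈ C, ∃ y ∈ E, A x y)
    (aCF : ∃ x ∈ C, ∃ y ∈ F, A x y) (aDE : ∃ x ∈ D, ∃ y ∈ E, A x y)
    (aDF : ∃ x ∈ D, ∃ y ∈ F, A x y) (aEF : ∃ x ∈ E, ∃ y ∈ F, A x y) :
    IsK4Model A ![C, D, E, F] := by
  have adj_symm : ∀ {X Y : Set V}, (∃ x ∈ X, ∃ y ∈ Y, A x y) → ∃ x ∈ Y, ∃ y ∈ X, A x y :=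
    fun ⟨x, hx, y, hy, h⟩ ↦ ⟨y, hy, x, hx, hA _ _ h⟩
  refine ⟨?_, ?_, ?_, ?_⟩
  · simp only [Fin.forall_fin_succ, IsEmpty.forall_iff, and_true]
    exact ⟨nC, nD, nE, nF⟩
  · simp only [Fin.forall_fin_succ, IsEmpty.forall_iff, and_true]
    exact ⟨cC, cD, cE, cF⟩
  · intro i j x hi hj
    have h1 := dCD x
    have h2 := dCE x
    have h3 := dCF x
    have h4 := dDE x
    have h5 := dDF x
    have h6 := dEF x
    clear aCD aCE aCF aDE aDF aEF cC cD cE cF dCD dCE dCF dDE dDF dEF nC nD nE nF hA adj_symm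
    fin_cases i <;> fin_cases j <;> first | rfl | (simp at hi hj; tauto)
  · have a21 := adj_symm aCD
    have a31 := adj_symm aCE
    have a41 := adj_symm aCF
    have a32 := adj_symm aDE
    have a42 := adj_symm aDF
    have a43 := adj_symm aEF
    clear cC cD cE cF dCD dCE dCF dDE dDF dEF nC nD nE nF hA adj_symm
    intro i j hij
    fin_cases i <;> fin_cases j <;> first | exact absurd rfl hij | assumption

/-- A relation is acyclic if a rank function never decreases along it, and it is acyclic on the
levels of the rank function. -/
theorem acyclic_of_rank {R S : V → V → Prop} (c : V → ℕ)
    (h : ∀ x y, R x y → c x < c y ∨ c x = c y ∧ S x y) (hS : ∀ x, ¬ TransGen S x x) (x : V) :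
    ¬ TransGen R x x := by
  have key : ∀ x y, TransGen R x y → c x < c y ∨ c x = c y ∧ TransGen S x y := by
    intro x y hxy
    induction hxy with
    | single h1 => exact (h _ _ h1).imp id (And.imp id .single)
    | tail _ h2 ih =>
      rcases h _ _ h2 with h2 | ⟨e2, h2⟩ <;> rcases ih with h1 | ⟨e1, h1⟩
      · exact .inl (h1.trans h2)
      · exact .inl (e1 ▸ h2)
      · exact .inl (e2 ▸ h1)
      · exact .inr ⟨e1.trans e2, h1.tail h2⟩
  exact fun hx ↦ (key x x hx).elim (lt_irrefl _) fun h ↦ hS x h.2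

theorem wellFounded_of_acyclic [Finite V] (h : ∀ x, ¬ TransGen R x x) :
    WellFounded (TransGen R) :=
  have : Std.Irrefl (TransGen R) := ⟨h⟩
  Finite.wellFounded_of_trans_of_irrefl _

namespace IsBipolarRel

theorem asymm (h : IsBipolarRel R s t) {x y : V} (hxy : R x y) : ¬ R y x :=
  fun hyx ↦ h.acyclic x (.tail (.single hxy) hyx)

theorem not_transGen_of_reflTransGen (h : IsBipolarRel R s t) {x y : V}
    (hxy : TransGen R x y) : ¬ ReflTransGen R y x :=
  fun hyx ↦ h.acyclic x (hxy.trans_left hyx)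

theorem dual (h : IsBipolarRel R s t) : IsBipolarRel (fun x y ↦ R y x) t s where
  acyclic x hx := h.acyclic x (transGen_swap.1 hx)
  exists_in := h.exists_out
  exists_out := h.exists_in
  not_in := h.not_out
  not_out := h.not_in
  ne := h.ne.symm

theorem reflTransGen_source [Finite V] (h : IsBipolarRel R s t) (x : V) :
    ReflTransGen R s x := by
  induction x using (wellFounded_of_acyclic h.acyclic).induction with
  | _ x ih =>
    by_cases hx : x = s
    · exact hx ▸ .refl
    · obtain ⟨y, hy⟩ := h.exists_in x hx
      exact (ih y (.single hy)).tail hy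

theorem reflTransGen_sink [Finite V] (h : IsBipolarRel R s t) (x : V) :
    ReflTransGen R x t :=
  reflTransGen_swap.1 (h.dual.reflTransGen_source x)

/-- Two arcs into `z` come from a fork below `z`. -/
theorem exists_isFork [Finite V] (h : IsBipolarRel R s t) {x y z : V} (hxy : x ≠ y)
    (hx : R x z) (hy : R y z) : ∃ w, IsFork R w z := by
  have hwf := wellFounded_of_acyclic h.dual.acyclic
  -- A highest common ancestor: if the paths to `x` and `y` shared their first step, that step would
  -- lead to a higher one.
  obtain ⟨w, ⟨hwx, hwy⟩, hmax⟩ := hwf.has_min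
    {w | ReflTransGen R w x ∧ ReflTransGen R w y}
    ⟨s, h.reflTransGen_source x, h.reflTransGen_source y⟩
  rcases hwx.cases_head with rfl | ⟨p, hwp, hpx⟩
  · rcases hwy.cases_head with rfl | ⟨q, hwq, hqy⟩
    · exact absurd rfl hxy
    · refine ⟨w, z, q, ?_, hx, hwq, .refl, hqy.tail hy⟩
      rintro rfl
      exact h.acyclic z (.tail' hqy hy)
  · rcases hwy.cases_head with rfl | ⟨q, hwq, hqy⟩
    · refine ⟨w, p, z, ?_, hwp, hy, hpx.tail hx, .refl⟩
      rintro rfl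
      exact h.acyclic p (.tail' hpx hx)
    · refine ⟨w, p, q, ?_, hwp, hwq, hpx.tail hx, hqy.tail hy⟩
      rintro rfl
      exact hmax p ⟨hpx, hqy⟩ (.single hwp)

end IsBipolarRel

/-! ### Thetas refute both sides of the equivalence -/

/-- Two paths from `w` to `v` through `p` and `q`, internally disjoint, and an arc from the
interior vertex `p` to a vertex `r` from which `v` cannot be reached. -/
structure IsTheta (R : V → V → Prop) (w v p q r : V) : Prop where
  left : R w p
  right : R w q
  left_reach : TransGen R p v
  right_reach : ReflTransGen R q v
  disjoint : ∀ x, ReflTransGen R p x → ReflTransGen R q x → ¬ TransGen R x v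
  exit : R p r
  exit_not_reach : ¬ ReflTransGen R r v

namespace IsTheta

variable {w v p q r : V}

theorem ne_sink [Finite V] (hR : IsBipolarRel R s t) (h : IsTheta R w v p q r) : v ≠ t := by
  rintro rfl
  exact h.exit_not_reach (hR.reflTransGen_sink r)

/-- The branch sets are the ancestors of `w`, the strict descendants of `v`, the interval from `q`
to `v`, and the descendants of `p` not reachable from `v`. The first contains `s` and the second
`t`, so the edge `st` joins them. -/
theorem exists_isK4Model [Finite V] (hR : IsBipolarRel R s t) (h : IsTheta R w v p q r) :
    ∃ B, IsK4Model (RootedAdj R s t) B := by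
  have hA : ∀ x y, RootedAdj R s t x y → RootedAdj R s t y x := fun _ _ ↦ RootedAdj.symm
  have adj_symm : ∀ {X Y : Set V}, (∃ x ∈ X, ∃ y ∈ Y, RootedAdj R s t x y) →
      ∃ x ∈ Y, ∃ y ∈ X, RootedAdj R s t x y :=
    fun ⟨x, hx, y, hy, h⟩ ↦ ⟨y, hy, x, hx, h.symm⟩
  have hvt := h.ne_sink hR
  let Bw : Set V := {x | ReflTransGen R x w}
  let Bt : Set V := {x | TransGen R v x}
  let Bv : Set V := {x | ReflTransGen R q x ∧ ReflTransGen R x v}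
  let Bp : Set V := {x | ReflTransGen R p x ∧ ¬ ReflTransGen R v x}
  have hpv := h.left_reach
  have hwv : TransGen R w v := .head h.left hpv
  have htB : TransGen R v t :=
    (reflTransGen_iff_eq_or_transGen.1 (hR.reflTransGen_sink v)).resolve_left (Ne.symm hvt)
  have hpB : p ∈ Bp := ⟨.refl, hR.not_transGen_of_reflTransGen hpv⟩
  have cw : ∀ x ∈ Bw, ReflTransGen (fun u z ↦ RootedAdj R s t u z ∧ z ∈ Bw) x w := by
    intro x hx
    induction hx using ReflTransGen.head_induction_on with
    | refl => exact .refl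
    | head h1 h2 ih => exact .head ⟨.inl h1, h2⟩ ih
  have ct : ∀ x ∈ Bt, ReflTransGen (fun u z ↦ RootedAdj R s t u z ∧ z ∈ Bt) x t := by
    intro x hx
    have := hR.reflTransGen_sink x
    induction this using ReflTransGen.head_induction_on with
    | refl => exact .refl
    | head h1 h2 ih => exact .head ⟨.inl h1, hx.tail h1⟩ (ih (hx.tail h1))
  have cv : ∀ x ∈ Bv, ReflTransGen (fun u z ↦ RootedAdj R s t u z ∧ z ∈ Bv) x v := by
    rintro x ⟨hqx, hxv⟩
    induction hxv using ReflTransGen.head_induction_on with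
    | refl => exact .refl
    | head h1 h2 ih => exact .head ⟨.inl h1, hqx.tail h1, h2⟩ (ih (hqx.tail h1))
  have cp : ∀ x ∈ Bp, ReflTransGen (fun u z ↦ RootedAdj R s t u z ∧ z ∈ Bp) x p := by
    rintro x ⟨hpx, hxv⟩
    induction hpx with
    | refl => exact .refl
    | tail h1 h2 ih =>
      have hn := fun hv ↦ hxv (ReflTransGen.tail hv h2)
      exact .head ⟨.inr (.inl h2), h1, hn⟩ (ih hn)
  have dwt : ∀ x, x ∈ Bw → x ∉ Bt := fun x hx hx' ↦
    hR.acyclic v (.trans (hx'.trans_left hx) hwv)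
  have dwv : ∀ x, x ∈ Bw → x ∉ Bv := fun x hx hx' ↦
    hR.acyclic w (.head' h.right (hx'.1.trans hx))
  have dwp : ∀ x, x ∈ Bw → x ∉ Bp := fun x hx hx' ↦
    hR.acyclic w (.head' h.left (hx'.1.trans hx))
  have dtv : ∀ x, x ∈ Bt → x ∉ Bv := fun x hx hx' ↦
    hR.acyclic v (hx.trans_left hx'.2)
  have dtp : ∀ x, x ∈ Bt → x ∉ Bp := fun x hx hx' ↦ hx'.2 hx.to_reflTransGen
  have dvp : ∀ x, x ∈ Bv → x ∉ Bp := by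
    rintro x ⟨hqx, hxv⟩ ⟨hpx, hvx⟩
    rcases reflTransGen_iff_eq_or_transGen.1 hxv with rfl | hxv
    · exact hvx .refl
    · exact h.disjoint x hpx hqx hxv
  have awt : ∃ x ∈ Bw, ∃ y ∈ Bt, RootedAdj R s t x y :=
    ⟨s, hR.reflTransGen_source w, t, htB, .inr (.inr (.inl ⟨rfl, rfl⟩))⟩
  have awv : ∃ x ∈ Bw, ∃ y ∈ Bv, RootedAdj R s t x y :=
    ⟨w, .refl, q, ⟨.refl, h.right_reach⟩, .inl h.right⟩
  have awp : ∃ x ∈ Bw, ∃ y ∈ Bp, RootedAdj R s t x y := ⟨w, .refl, p, hpB, .inl h.left⟩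
  have avt : ∃ x ∈ Bv, ∃ y ∈ Bt, RootedAdj R s t x y := by
    obtain ⟨y, hy⟩ := hR.exists_out v hvt
    exact ⟨v, ⟨h.right_reach, .refl⟩, y, .single hy, .inl hy⟩
  have apv : ∃ x ∈ Bp, ∃ y ∈ Bv, RootedAdj R s t x y := by
    obtain ⟨x, hpx, hxv⟩ := TransGen.tail'_iff.1 hpv
    exact ⟨x, ⟨hpx, hR.not_transGen_of_reflTransGen (.single hxv)⟩, v,
      ⟨h.right_reach, .refl⟩, .inl hxv⟩
  -- Follow a path from `p` through `r` to `t`. It leaves `Bp` at the first vertex reachable from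
  -- `v`, and this is not `v` itself because `r` does not reach `v`.
  have apt : ∃ x ∈ Bp, ∃ y ∈ Bt, RootedAdj R s t x y := by
    have key : ∀ y, ReflTransGen R r y → y ∈ Bp ∨ ∃ x ∈ Bp, ∃ y ∈ Bt, RootedAdj R s t x y := by
      have step : ∀ x y, x ∈ Bp → R x y → ReflTransGen R r y →
          y ∈ Bp ∨ ∃ x ∈ Bp, ∃ y ∈ Bt, RootedAdj R s t x y := by
        intro x y hx hxy hry
        by_cases hvy : ReflTransGen R v y
        · rcases reflTransGen_iff_eq_or_transGen.1 hvy with rfl | hvy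
          · exact absurd hry h.exit_not_reach
          · exact .inr ⟨x, hx, y, hvy, .inl hxy⟩
        · exact .inl ⟨hx.1.tail hxy, hvy⟩
      intro y hy
      induction hy with
      | refl => exact step p r hpB h.exit .refl
      | tail h1 h2 ih => exact ih.elim (fun hx ↦ step _ _ hx h2 (h1.tail h2)) .inr
    exact (key t (hR.reflTransGen_sink r)).resolve_left fun ht ↦ ht.2 htB.to_reflTransGen
  exact ⟨_, .of_pairs (C := Bw) (D := Bt) (E := Bv) (F := Bp) hA
    ⟨w, .refl⟩ ⟨t, htB⟩ ⟨v, h.right_reach, .refl⟩ ⟨p, hpB⟩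
    (reflTransGen_within_of_center (B := Bw) hA cw) (reflTransGen_within_of_center (B := Bt) hA ct)
    (reflTransGen_within_of_center (B := Bv) hA cv) (reflTransGen_within_of_center (B := Bp) hA cp)
    dwt dwv dwp dtv dtp dvp awt awv awp (adj_symm avt) (adj_symm apt) (adj_symm apv)⟩

/-- Reversing all arcs on the directed paths from `p` to `v` gives another bipolar relation. -/
theorem not_isUniqueBipolar [Finite V] (hR : IsBipolarRel R s t) (h : IsTheta R w v p q r) :
    ¬ IsUniqueBipolar R s t := by
  have hvt := h.ne_sink hR
  have hpv := h.left_reach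
  let I : Set V := {x | ReflTransGen R p x ∧ ReflTransGen R x v}
  have hpI : p ∈ I := ⟨.refl, hpv.to_reflTransGen⟩
  have hvI : v ∈ I := ⟨hpv.to_reflTransGen, .refl⟩
  let R' : V → V → Prop := fun x y ↦ (R x y ∧ ¬ (x ∈ I ∧ y ∈ I)) ∨ (R y x ∧ x ∈ I ∧ y ∈ I)
  have hsI : s ∉ I := by
    rintro ⟨hps, -⟩
    obtain ⟨y, -, hy⟩ := TransGen.tail'_iff.1 (TransGen.head' h.left hps)
    exact hR.not_in y hy
  have htI : t ∉ I := by
    rintro ⟨-, htv⟩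
    rcases htv.cases_head with rfl | ⟨y, hy, -⟩
    exacts [hvt rfl, hR.not_out y hy]
  let S : V → V → Prop := fun x y ↦ (x ∈ I ∧ y ∈ I ∧ R y x) ∨ (x ∉ I ∧ y ∉ I ∧ R x y)
  have hS : ∀ x, ¬ TransGen S x x := by
    have key : ∀ x y, TransGen S x y →
        (x ∈ I ∧ y ∈ I ∧ TransGen R y x) ∨ (x ∉ I ∧ y ∉ I ∧ TransGen R x y) := by
      intro x y hxy
      induction hxy with
      | single h1 =>
        exact Or.imp (fun h ↦ ⟨h.1, h.2.1, .single h.2.2⟩) (fun h ↦ ⟨h.1, h.2.1, .single h.2.2⟩) h1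
      | tail _ h2 ih =>
        rcases ih with ih | ih <;> rcases h2 with h2 | h2
        · exact .inl ⟨ih.1, h2.2.1, .head h2.2.2 ih.2.2⟩
        · exact absurd ih.2.1 h2.1
        · exact absurd h2.1 ih.2.1
        · exact .inr ⟨ih.1, h2.2.1, .tail ih.2.2 h2.2.2⟩
    exact fun x hx ↦ (key x x hx).elim (fun h ↦ hR.acyclic x h.2.2) fun h ↦ hR.acyclic x h.2.2
  classical
  -- Rank 0 is below `v` but outside `I`, rank 1 is `I`, rank 2 is the rest. Arcs of `R'` never
  -- descend, and each level is acyclic.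
  let c : V → ℕ := fun x ↦ if x ∈ I then 1 else if ReflTransGen R x v then 0 else 2
  have hc : ∀ x y, R' x y → c x < c y ∨ c x = c y ∧ S x y := by
    rintro x y (⟨hxy, hn⟩ | ⟨hyx, hx, hy⟩)
    · have h1 : x ∈ I → ReflTransGen R y v → y ∈ I := fun hx hy ↦ ⟨hx.1.tail hxy, hy⟩
      have h2 : ReflTransGen R y v → ReflTransGen R x v := .head hxy
      have h3 : y ∈ I → ReflTransGen R y v := fun hy ↦ hy.2
      simp only [c, S]
      split_ifs <;> simp_all
    · exact .inr ⟨by simp [c, hx, hy], .inl ⟨hx, hy, hyx⟩⟩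
  -- Only `v` and `p` need a substitute arc: `v` is entered by the last arc of the branch through
  -- `q` (from `w` if `q = v`), and `p` is left by the arc to `r`.
  have hR' : IsBipolarRel R' s t := by
    refine ⟨?_, ?_, ?_, ?_, ?_, hR.ne⟩
    · exact acyclic_of_rank c hc hS
    · intro x hx
      by_cases hxI : x ∈ I
      · rcases reflTransGen_iff_eq_or_transGen.1 hxI.2 with rfl | hxv
        · rcases h.right_reach.cases_tail with rfl | ⟨y, hqy, hyv⟩
          · refine ⟨w, .inl ⟨h.right, fun hw ↦ ?_⟩⟩
            exact hR.acyclic w (.head' h.left hw.1.1)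
          · exact ⟨y, .inl ⟨hyv, fun hy ↦ h.disjoint y hy.1.1 hqy (.single hyv)⟩⟩
        · obtain ⟨y, hxy, hyv⟩ := TransGen.head'_iff.1 hxv
          exact ⟨y, .inr ⟨hxy, ⟨hxI.1.tail hxy, hyv⟩, hxI⟩⟩
      · obtain ⟨y, hy⟩ := hR.exists_in x hx
        exact ⟨y, .inl ⟨hy, fun hI ↦ hxI hI.2⟩⟩
    · intro x hx
      by_cases hxI : x ∈ I
      · rcases hxI.1.cases_tail with rfl | ⟨y, hpy, hyx⟩
        · exact ⟨r, .inl ⟨h.exit, fun hI ↦ h.exit_not_reach hI.2.2⟩⟩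
        · exact ⟨y, .inr ⟨hyx, hxI, hpy, .head hyx hxI.2⟩⟩
      · obtain ⟨y, hy⟩ := hR.exists_out x hx
        exact ⟨y, .inl ⟨hy, fun hI ↦ hxI hI.1⟩⟩
    · rintro y (⟨hy, -⟩ | ⟨-, -, hs⟩)
      exacts [hR.not_in y hy, hsI hs]
    · rintro y (⟨hy, -⟩ | ⟨-, ht, -⟩)
      exacts [hR.not_out y hy, htI ht]
  intro hU
  obtain ⟨y, hpy, hyv⟩ := TransGen.head'_iff.1 hpv
  have hyI : y ∈ I := ⟨.single hpy, hyv⟩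
  rcases hU R' hR' (fun x y ↦ by simp only [R']; tauto) p y hpy with ⟨-, hn⟩ | ⟨hyp, -⟩
  exacts [hn ⟨hpI, hyI⟩, hR.asymm hpy hyp]

end IsTheta

end

/-! ### Elimination of a vertex of degree two -/

/-- The relation obtained by deleting the vertex `v` and joining its in-neighbours to its
out-neighbours. -/
def eliminate {V : Type*} (R : V → V → Prop) (v : V) (x y : {x : V // x ≠ v}) : Prop :=
  R x y ∨ R x v ∧ R v y

/-- `a → v → b` are the only arcs at the vertex `v`, which is not a pole. -/
structure IsSeries {V : Type*} (R : V → V → Prop) (s t v a b : V) : Prop where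
  ne_source : s ≠ v
  ne_sink : t ≠ v
  in_iff : ∀ x, R x v ↔ x = a
  out_iff : ∀ x, R v x ↔ x = b

section

variable {V : Type*} {R : V → V → Prop} {s t : V}

theorem IsBipolarRel.eliminate (h : IsBipolarRel R s t) {v : V} (hs : s ≠ v) (ht : t ≠ v) :
    IsBipolarRel (eliminate R v) ⟨s, hs⟩ ⟨t, ht⟩ where
  acyclic x hx := by
    refine h.acyclic x (TransGen.lift' Subtype.val ?_ _ _ hx)
    rintro a b (hab | ⟨h1, h2⟩)
    exacts [.single hab, .tail (.single h1) h2]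
  exists_in := by
    rintro ⟨x, hx⟩ hxs
    obtain ⟨y, hy⟩ := h.exists_in x (by simpa using hxs)
    by_cases hyv : y = v
    · subst hyv
      obtain ⟨z, hz⟩ := h.exists_in y hs.symm
      exact ⟨⟨z, fun e ↦ h.asymm (e ▸ hz) hz⟩, .inr ⟨hz, hy⟩⟩
    · exact ⟨⟨y, hyv⟩, .inl hy⟩
  exists_out := by
    rintro ⟨x, hx⟩ hxt
    obtain ⟨y, hy⟩ := h.exists_out x (by simpa using hxt)
    by_cases hyv : y = v
    · subst hyv
      obtain ⟨z, hz⟩ := h.exists_out y ht.symm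
      exact ⟨⟨z, fun e ↦ h.asymm (e ▸ hz) hz⟩, .inr ⟨hy, hz⟩⟩
    · exact ⟨⟨y, hyv⟩, .inl hy⟩
  not_in := by
    rintro y (hy | ⟨-, hy⟩)
    exacts [h.not_in _ hy, h.not_in _ hy]
  not_out := by
    rintro y (hy | ⟨hy, -⟩)
    exacts [h.not_out _ hy, h.not_out _ hy]
  ne e := h.ne (congrArg Subtype.val e)

namespace IsSeries

variable {v a b : V}

theorem ne_left (hR : IsBipolarRel R s t) (h : IsSeries R s t v a b) : a ≠ v := by
  rintro rfl
  exact hR.asymm ((h.in_iff a).2 rfl) ((h.in_iff a).2 rfl)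

theorem ne_right (hR : IsBipolarRel R s t) (h : IsSeries R s t v a b) : b ≠ v := by
  rintro rfl
  exact hR.asymm ((h.out_iff b).2 rfl) ((h.out_iff b).2 rfl)

theorem left_ne_right (hR : IsBipolarRel R s t) (h : IsSeries R s t v a b) : a ≠ b := by
  rintro rfl
  exact hR.asymm ((h.in_iff a).2 rfl) ((h.out_iff a).2 rfl)

/-- In a bipolar relation with the same underlying graph, `v` still has one arc in and one out. -/
theorem of_same_graph (hR : IsBipolarRel R s t) (h : IsSeries R s t v a b) {R' : V → V → Prop}
    (hR' : IsBipolarRel R' s t) (hs : ∀ x y, R' x y ∨ R' y x ↔ R x y ∨ R y x) :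
    IsSeries R' s t v a b ∨ IsSeries R' s t v b a := by
  obtain ⟨x, hx⟩ := hR'.exists_in v h.ne_source.symm
  obtain ⟨y, hy⟩ := hR'.exists_out v h.ne_sink.symm
  have nb : ∀ z, R' z v ∨ R' v z ↔ z = a ∨ z = b := fun z ↦ by
    rw [hs, h.in_iff, h.out_iff]
  have hx' := (nb x).1 (.inl hx)
  have hy' := (nb y).1 (.inr hy)
  have hab := h.left_ne_right hR
  have asym : ∀ z, R' z v → ¬ R' v z := fun z ↦ hR'.asymm
  have h1 := h.ne_source
  have h2 := h.ne_sink
  rcases hx' with rfl | rfl <;> rcases hy' with rfl | rfl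
  · exact absurd hy (asym _ hx)
  · refine .inl ⟨h1, h2, fun z ↦ ?_, fun z ↦ ?_⟩ <;> grind
  · refine .inr ⟨h1, h2, fun z ↦ ?_, fun z ↦ ?_⟩ <;> grind
  · exact absurd hy (asym _ hx)

/-- Eliminating `v` from a competitor gives a competitor of the smaller relation, where uniqueness
applies. The resulting arc from `a` to `b` excludes the traversal of `v` from `b` to `a`. -/
theorem isUniqueBipolar_of_eliminate (hR : IsBipolarRel R s t) (h : IsSeries R s t v a b)
    (hU : IsUniqueBipolar (eliminate R v) ⟨s, h.ne_source⟩ ⟨t, h.ne_sink⟩) :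
    IsUniqueBipolar R s t := by
  intro R' hR' hs
  have ha := h.ne_left hR
  have hb := h.ne_right hR
  have hser := h.of_same_graph hR hR' hs
  have key := hU _ (hR'.eliminate h.ne_source h.ne_sink) (by
    rintro ⟨x, hx⟩ ⟨y, hy⟩
    have := hs x y
    simp only [_root_.eliminate, h.in_iff, h.out_iff]
    rcases hser with h' | h' <;> simp only [h'.in_iff, h'.out_iff] <;> tauto)
  have hab := key ⟨a, ha⟩ ⟨b, hb⟩ (.inr ⟨(h.in_iff a).2 rfl, (h.out_iff b).2 rfl⟩)
  have hser : IsSeries R' s t v a b := by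
    refine hser.resolve_right fun h' ↦ ?_
    have hba : R' b v := (h'.in_iff b).2 rfl
    have hva : R' v a := (h'.out_iff a).2 rfl
    rcases hab with hab | ⟨hab, -⟩
    · exact hR'.acyclic v (.tail (.tail (.single hva) hab) hba)
    · exact hR'.asymm hva hab
  intro x y hxy
  by_cases hx : x = v
  · subst hx
    rwa [hser.out_iff, ← h.out_iff]
  by_cases hy : y = v
  · subst hy
    rwa [hser.in_iff, ← h.in_iff]
  rcases key ⟨x, hx⟩ ⟨y, hy⟩ (.inl hxy) with h1 | ⟨h1, h2⟩
  · exact h1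
  -- Here the smaller relation only gives `x → v → y`; an arc from `y` back to `x` would close a
  -- cycle.
  · refine ((hs x y).2 (.inl hxy)).resolve_right fun h3 ↦ ?_
    exact hR'.acyclic v (.tail (.tail (.single h2) h3) h1)

/-- Subdividing the arc `c → d` of a bipolar relation by a new vertex `v` that replaces, or is
parallel to, that arc gives a bipolar relation. -/
theorem _root_.IsBipolarRel.subdivide {v : V} {hs : s ≠ v} {ht : t ≠ v}
    {Q : {x : V // x ≠ v} → {x : V // x ≠ v} → Prop} (hQ : IsBipolarRel Q ⟨s, hs⟩ ⟨t, ht⟩)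
    {c d : {x : V // x ≠ v}} (hcd : Q c d) {R' : V → V → Prop}
    (hin : ∀ x, R' x v ↔ x = c) (hout : ∀ x, R' v x ↔ x = d)
    (hsub : ∀ x y : {x : V // x ≠ v}, R' x y → Q x y)
    (hsup : ∀ x y : {x : V // x ≠ v}, Q x y → R' x y ∨ x = c ∧ y = d) :
    IsBipolarRel R' s t where
  acyclic := by
    -- Paths ending at `v` are tracked by their previous vertex `c`, so that passing through `v`
    -- becomes the arc `c → d` of `Q`.
    have key : ∀ (x : {x : V // x ≠ v}) (y : V), TransGen R' x y →
        (∀ hy : y ≠ v, TransGen Q x ⟨y, hy⟩) ∧ (y = v → ReflTransGen Q x c) := by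
      intro x y hxy
      induction hxy with
      | @single z h1 =>
        refine ⟨fun hy ↦ .single (hsub x ⟨z, hy⟩ h1), ?_⟩
        rintro rfl
        rw [Subtype.ext ((hin _).1 h1)]
      | @tail z w _ h2 ih =>
        by_cases hz : z = v
        · subst hz
          obtain rfl := (hout _).1 h2
          exact ⟨fun _ ↦ .tail' (ih.2 rfl) hcd, fun e ↦ absurd e d.2⟩
        · have h3 := ih.1 hz
          refine ⟨fun hy ↦ h3.tail (hsub ⟨z, hz⟩ ⟨w, hy⟩ h2), ?_⟩
          rintro rfl
          obtain rfl := (hin _).1 h2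
          exact h3.to_reflTransGen
    intro x hx
    by_cases hxv : x = v
    · subst hxv
      obtain ⟨y, hy, hyx⟩ := TransGen.head'_iff.1 hx
      obtain rfl := (hout _).1 hy
      have := (reflTransGen_iff_eq_or_transGen.1 hyx).resolve_left d.2.symm
      exact hQ.not_transGen_of_reflTransGen (.single hcd) ((key d _ this).2 rfl)
    · exact hQ.acyclic _ ((key ⟨x, hxv⟩ x hx).1 hxv)
  exists_in x hx := by
    by_cases hxv : x = v
    · subst hxv
      exact ⟨c, (hin _).2 rfl⟩
    · obtain ⟨y, hy⟩ := hQ.exists_in ⟨x, hxv⟩ (by simpa using hx)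
      rcases hsup _ _ hy with h | ⟨-, h⟩
      exacts [⟨y, h⟩, ⟨v, (hout _).2 (congrArg Subtype.val h)⟩]
  exists_out x hx := by
    by_cases hxv : x = v
    · subst hxv
      exact ⟨d, (hout _).2 rfl⟩
    · obtain ⟨y, hy⟩ := hQ.exists_out ⟨x, hxv⟩ (by simpa using hx)
      rcases hsup _ _ hy with h | ⟨h, -⟩
      exacts [⟨y, h⟩, ⟨v, (hin _).2 (congrArg Subtype.val h)⟩]
  not_in y hy := by
    by_cases hyv : y = v
    · subst hyv
      have : d = ⟨s, hs⟩ := Subtype.ext ((hout _).1 hy).symm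
      exact hQ.not_in c (this ▸ hcd)
    · exact hQ.not_in _ (hsub ⟨y, hyv⟩ ⟨s, hs⟩ hy)
  not_out y hy := by
    by_cases hyv : y = v
    · subst hyv
      have : c = ⟨t, ht⟩ := Subtype.ext ((hin _).1 hy).symm
      exact hQ.not_out d (this ▸ hcd)
    · exact hQ.not_out _ (hsub ⟨t, ht⟩ ⟨y, hyv⟩ hy)
  ne e := hQ.ne (Subtype.ext e)

/-- A competitor `Q` directs the edge between `a` and `b` in some way `c → d`. Subdividing that arc
by `v` lifts `Q` to a competitor of `R`, and what uniqueness gives there projects back to `Q`. -/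
theorem isUniqueBipolar_eliminate (hR : IsBipolarRel R s t) (h : IsSeries R s t v a b)
    (hU : IsUniqueBipolar R s t) :
    IsUniqueBipolar (eliminate R v) ⟨s, h.ne_source⟩ ⟨t, h.ne_sink⟩ := by
  intro Q hQ hs
  have ha := h.ne_left hR
  have hb := h.ne_right hR
  have hab := (hs ⟨a, ha⟩ ⟨b, hb⟩).2
    (.inl (.inr ⟨(h.in_iff a).2 rfl, (h.out_iff b).2 rfl⟩))
  obtain ⟨c, d, hcd, hc⟩ : ∃ c d : {x : V // x ≠ v}, Q c d ∧
      ((c.1 = a ∧ d.1 = b) ∨ (c.1 = b ∧ d.1 = a)) := by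
    rcases hab with hab | hab
    exacts [⟨_, _, hab, .inl ⟨rfl, rfl⟩⟩, ⟨_, _, hab, .inr ⟨rfl, rfl⟩⟩]
  -- The last condition drops `c → d` when it is due to the elimination alone, and keeps it when it
  -- was already an edge parallel to the path through `v`.
  let R' : V → V → Prop := fun x y ↦ (x = c ∧ y = v) ∨ (x = v ∧ y = d) ∨
    ∃ (hx : x ≠ v) (hy : y ≠ v), Q ⟨x, hx⟩ ⟨y, hy⟩ ∧ (R x y ∨ R y x)
  have hin : ∀ x, R' x v ↔ x = c := by
    intro x
    have := d.2
    simp [R', this.symm]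
  have hout : ∀ x, R' v x ↔ x = d := by
    intro x
    have := c.2
    simp [R', this.symm]
  have hmid : ∀ x y : {x : V // x ≠ v}, R' x y ↔ Q x y ∧ (R x y ∨ R y x) := by
    rintro ⟨x, hx⟩ ⟨y, hy⟩
    simp [R', hx, hy]
  have hQs : ∀ x y : {x : V // x ≠ v}, Q x y → (R x y ∨ R y x) ∨ x = c ∧ y = d := by
    intro x y hxy
    have h1 := (hs x y).1 (.inl hxy)
    simp only [_root_.eliminate, h.in_iff, h.out_iff] at h1
    have h2 : ¬ (x = d ∧ y = c) := by
      rintro ⟨rfl, rfl⟩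
      exact hQ.asymm hxy hcd
    rw [Subtype.ext_iff, Subtype.ext_iff] at h2
    rw [Subtype.ext_iff, Subtype.ext_iff]
    rcases h1 with (h1 | ⟨e1, e2⟩) | h1 | ⟨e1, e2⟩
    · exact .inl (.inl h1)
    · rcases hc with ⟨e3, e4⟩ | ⟨e3, e4⟩
      · exact .inr ⟨e1.trans e3.symm, e2.trans e4.symm⟩
      · exact absurd ⟨e1.trans e4.symm, e2.trans e3.symm⟩ h2
    · exact .inl (.inr h1)
    · rcases hc with ⟨e3, e4⟩ | ⟨e3, e4⟩
      · exact absurd ⟨e2.trans e4.symm, e1.trans e3.symm⟩ h2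
      · exact .inr ⟨e2.trans e3.symm, e1.trans e4.symm⟩
  have hR' : IsBipolarRel R' s t := hQ.subdivide hcd hin hout
    (fun x y hxy ↦ ((hmid x y).1 hxy).1) fun x y hxy ↦
      (hQs x y hxy).imp (fun h ↦ (hmid x y).2 ⟨hxy, h⟩) id
  have hv : ∀ x, R' x v ∨ R' v x ↔ R x v ∨ R v x := by
    intro x
    rw [hin, hout, h.in_iff, h.out_iff]
    rcases hc with ⟨e1, e2⟩ | ⟨e1, e2⟩ <;> rw [e1, e2]
    exact or_comm
  have key := hU R' hR' (by
    intro x y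
    by_cases hx : x = v
    · rw [hx, or_comm, hv, or_comm]
    by_cases hy : y = v
    · rw [hy, hv]
    have h1 := hmid ⟨x, hx⟩ ⟨y, hy⟩
    have h2 := hmid ⟨y, hy⟩ ⟨x, hx⟩
    have h3 : R x y ∨ R y x → _ := fun h ↦ (hs ⟨x, hx⟩ ⟨y, hy⟩).2 (h.imp .inl .inl)
    rw [h1, h2]
    clear_value R'
    constructor
    · rintro (⟨-, h⟩ | ⟨-, h⟩)
      exacts [h, h.symm]
    · exact fun h ↦ (h3 h).imp (⟨·, h⟩) (⟨·, h.symm⟩))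
  rintro x y (hxy | ⟨hx, hy⟩)
  · exact ((hmid x y).1 (key _ _ hxy)).1
  · have h1 := Subtype.ext ((hin _).1 (key _ _ hx))
    have h2 := Subtype.ext ((hout _).1 (key _ _ hy))
    rwa [h1, h2]

theorem rootedAdj_iff (h : IsSeries R s t v a b) (x : V) :
    RootedAdj R s t v x ↔ x = a ∨ x = b := by
  have := h.ne_source
  have := h.ne_sink
  simp only [RootedAdj, h.in_iff, h.out_iff]
  grind

theorem rootedAdj_eliminate_iff (h : IsSeries R s t v a b) (x y : {x : V // x ≠ v}) :
    RootedAdj (eliminate R v) ⟨s, h.ne_source⟩ ⟨t, h.ne_sink⟩ x y ↔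
      RootedAdj R s t x y ∨ (x.1 = a ∧ y.1 = b) ∨ (x.1 = b ∧ y.1 = a) := by
  simp only [RootedAdj, _root_.eliminate, h.in_iff, h.out_iff, Subtype.ext_iff]
  tauto

/-- A model survives subdivision of the edge `ab`: the new vertex `v` joins the branch set of `a`,
if there is one, and `v` to `b` then does the work of the subdivided edge. -/
theorem exists_isK4Model_of_eliminate (h : IsSeries R s t v a b)
    (hB : ∃ B, IsK4Model (RootedAdj (eliminate R v) ⟨s, h.ne_source⟩ ⟨t, h.ne_sink⟩) B) :
    ∃ B, IsK4Model (RootedAdj R s t) B := by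
  obtain ⟨B, hB⟩ := hB
  have va : RootedAdj R s t v a := (h.rootedAdj_iff a).2 (.inl rfl)
  have vb : RootedAdj R s t v b := (h.rootedAdj_iff b).2 (.inr rfl)
  let C : Fin 4 → Set V := fun i ↦ {x | (∃ y ∈ B i, y.1 = x) ∨ x = v ∧ ∃ y ∈ B i, y.1 = a}
  have mem : ∀ i (x : {x : V // x ≠ v}), x.1 ∈ C i ↔ x ∈ B i := by
    intro i x
    have := x.2
    simp only [C, Set.mem_ofPred_eq]
    constructor
    · rintro (⟨y, hy, e⟩ | ⟨e, -⟩)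
      exacts [Subtype.ext e ▸ hy, absurd e this]
    · exact fun hx ↦ .inl ⟨x, hx, rfl⟩
  have conn : ∀ i, ∀ x ∈ B i, ∀ y ∈ B i,
      ReflTransGen (fun u w ↦ RootedAdj R s t u w ∧ w ∈ C i) x.1 y.1 := by
    intro i x hx y hy
    have := hB.connected i x hx y hy
    clear hy
    induction this with
    | refl => exact .refl
    | @tail u w h1 h2 ih =>
      have hu : u ∈ B i := by
        rcases h1.cases_tail with rfl | ⟨_, _, h⟩
        exacts [hx, h.2]
      obtain ⟨h2, hw⟩ := h2
      rcases (h.rootedAdj_eliminate_iff u w).1 h2 with h3 | ⟨h3, h4⟩ | ⟨h3, h4⟩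
      · exact ih.tail ⟨h3, (mem i w).2 hw⟩
      · refine (ih.tail (c := v) ⟨h3 ▸ va.symm, .inr ⟨rfl, u, hu, h3⟩⟩).tail ⟨h4 ▸ vb, ?_⟩
        exact (mem i w).2 hw
      · refine (ih.tail (c := v) ⟨h3 ▸ vb.symm, .inr ⟨rfl, w, hw, h4⟩⟩).tail ⟨h4 ▸ va, ?_⟩
        exact (mem i w).2 hw
  refine ⟨C, ?_, ?_, ?_, ?_⟩
  · intro i
    obtain ⟨x, hx⟩ := hB.nonempty i
    exact ⟨x, .inl ⟨x, hx, rfl⟩⟩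
  · intro i
    obtain ⟨c, hc, hca⟩ : ∃ c ∈ B i, v ∈ C i → c.1 = a := by
      by_cases hv : ∃ y ∈ B i, y.1 = a
      · obtain ⟨y, hy, e⟩ := hv
        exact ⟨y, hy, fun _ ↦ e⟩
      · obtain ⟨x, hx⟩ := hB.nonempty i
        refine ⟨x, hx, ?_⟩
        rintro (⟨y, -, e⟩ | ⟨-, hv'⟩)
        exacts [absurd e y.2, absurd hv' hv]
    refine reflTransGen_within_of_center (fun _ _ ↦ RootedAdj.symm) (c := c.1) ?_
    intro x hx
    by_cases hxv : x = v
    · subst hxv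
      exact .single ⟨(hca hx).symm ▸ va, (mem i c).2 hc⟩
    · exact conn i ⟨x, hxv⟩ ((mem i ⟨x, hxv⟩).1 hx) c hc
  · rintro i j x (⟨y, hy, rfl⟩ | ⟨rfl, y, hy, e⟩) hj
    · exact hB.inj i j y hy ((mem j y).1 hj)
    · rcases hj with ⟨z, -, e⟩ | ⟨-, z, hz, e'⟩
      · exact absurd e z.2
      · exact hB.inj i j y hy (Subtype.ext (e.trans e'.symm) ▸ hz)
  · have key : ∀ i j, (∃ x ∈ B i, x.1 = a) → (∃ y ∈ B j, y.1 = b) →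
        v ∈ C i ∧ ∃ y ∈ C j, RootedAdj R s t v y := by
      rintro i j ⟨x, hx, e⟩ ⟨y, hy, e'⟩
      exact ⟨.inr ⟨rfl, x, hx, e⟩, y, (mem j y).2 hy, e'.symm ▸ vb⟩
    intro i j hij
    obtain ⟨x, hx, y, hy, hxy⟩ := hB.adj i j hij
    rcases (h.rootedAdj_eliminate_iff x y).1 hxy with h3 | ⟨h3, h4⟩ | ⟨h3, h4⟩
    · exact ⟨x, (mem i x).2 hx, y, (mem j y).2 hy, h3⟩
    · obtain ⟨h5, z, hz, h6⟩ := key i j ⟨x, hx, h3⟩ ⟨y, hy, h4⟩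
      exact ⟨v, h5, z, hz, h6⟩
    · obtain ⟨h5, z, hz, h6⟩ := key j i ⟨y, hy, h4⟩ ⟨x, hx, h3⟩
      exact ⟨z, hz, v, h5, h6.symm⟩

/-- A branch set of a `K₄` model is not reduced to a vertex with only two neighbours. -/
theorem _root_.IsK4Model.mem_neighbor {A : V → V → Prop} {B : Fin 4 → Set V}
    (hB : IsK4Model A B) {v a b : V} (hv : ∀ x, A v x → x = a ∨ x = b) {i : Fin 4}
    (hi : v ∈ B i) : a ∈ B i ∨ b ∈ B i := by
  by_contra! hn
  have single : ∀ x ∈ B i, x = v := by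
    intro x hx
    rcases (hB.connected i v hi x hx).cases_head with rfl | ⟨y, ⟨hvy, hy⟩, -⟩
    · rfl
    · rcases hv y hvy with rfl | rfl
      exacts [absurd hy hn.1, absurd hy hn.2]
  -- The three other branch sets would each need one of the two neighbours, against the pigeonhole
  -- principle.
  have key : ∀ j, i ≠ j → a ∈ B j ∨ b ∈ B j := by
    intro j hij
    obtain ⟨x, hx, y, hy, hxy⟩ := hB.adj i j hij
    obtain rfl := single x hx
    rcases hv y hxy with rfl | rfl
    exacts [.inl hy, .inr hy]
  obtain ⟨j, k, l, hij, hik, hil, hjk, hjl, hkl⟩ : ∃ j k l : Fin 4,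
      i ≠ j ∧ i ≠ k ∧ i ≠ l ∧ j ≠ k ∧ j ≠ l ∧ k ≠ l := by
    clear hi hn single key
    revert i
    decide
  have e : ∀ j k x, x ∈ B j → x ∈ B k → j = k := hB.inj
  rcases key j hij with hj | hj <;> rcases key k hik with hk | hk <;>
    rcases key l hil with hl | hl <;>
    first
    | exact hjk (e _ _ _ hj hk)
    | exact hjl (e _ _ _ hj hl)
    | exact hkl (e _ _ _ hk hl)

/-- Contract `v` into a neighbour `c` in the same branch set, which exists by
`IsK4Model.mem_neighbor`. If no branch set contains `v`, the choice `c = a` is arbitrary. -/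
theorem exists_isK4Model_eliminate (hR : IsBipolarRel R s t) (h : IsSeries R s t v a b)
    (hB : ∃ B, IsK4Model (RootedAdj R s t) B) :
    ∃ B, IsK4Model (RootedAdj (eliminate R v) ⟨s, h.ne_source⟩ ⟨t, h.ne_sink⟩) B := by
  classical
  obtain ⟨B, hB⟩ := hB
  have nb := h.rootedAdj_iff
  obtain ⟨c, hc, hcab⟩ : ∃ c : {x : V // x ≠ v}, (∀ i, v ∈ B i → c.1 ∈ B i) ∧
      (c.1 = a ∨ c.1 = b) := by
    by_cases hv : ∃ i, v ∈ B i
    · obtain ⟨i, hi⟩ := hv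
      have huniq : ∀ j, v ∈ B j → j = i := fun j hj ↦ hB.inj j i v hj hi
      rcases hB.mem_neighbor (fun x ↦ (nb x).1) hi with ha | hb
      · exact ⟨⟨a, h.ne_left hR⟩, fun j hj ↦ huniq j hj ▸ ha, .inl rfl⟩
      · exact ⟨⟨b, h.ne_right hR⟩, fun j hj ↦ huniq j hj ▸ hb, .inr rfl⟩
    · exact ⟨⟨a, h.ne_left hR⟩, fun j hj ↦ absurd ⟨j, hj⟩ hv, .inl rfl⟩
  let f : V → {x : V // x ≠ v} := fun x ↦ if hx : x = v then c else ⟨x, hx⟩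
  have fv : f v = c := by simp [f]
  have fx : ∀ x (hx : x ≠ v), f x = ⟨x, hx⟩ := fun x hx ↦ by simp [f, hx]
  have fmem : ∀ i x, x ∈ B i → (f x).1 ∈ B i := by
    intro i x hx
    by_cases hxv : x = v
    · subst hxv
      rw [fv]
      exact hc i hx
    · rwa [fx x hxv]
  have fadj : ∀ y, RootedAdj R s t v y → c = f y ∨
      RootedAdj (_root_.eliminate R v) ⟨s, h.ne_source⟩ ⟨t, h.ne_sink⟩ c (f y) := by
    intro y hy
    have hyv : y ≠ v := by
      rcases (nb y).1 hy with rfl | rfl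
      exacts [h.ne_left hR, h.ne_right hR]
    rw [h.rootedAdj_eliminate_iff, fx y hyv, Subtype.ext_iff]
    have := (nb y).1 hy
    grind
  refine ⟨_, hB.image f ?_ ?_⟩
  · intro x y hxy
    by_cases hx : x = v
    · subst hx
      rw [fv]
      exact fadj y hxy
    by_cases hy : y = v
    · subst hy
      rw [fv]
      exact (fadj x hxy.symm).imp Eq.symm RootedAdj.symm
    rw [fx x hx, fx y hy, h.rootedAdj_eliminate_iff]
    exact .inr (.inl hxy)
  · intro i j x y hx hy e
    exact hB.inj i j _ (fmem i x hx) (e ▸ fmem j y hy)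

end IsSeries

end

/-! ### The trichotomy and the uniqueness criterion -/

section

variable {V : Type*} {R : V → V → Prop} {s t : V}

/-- A bipolar relation is trivial, or it has a vertex of degree two, or it contains a theta. -/
theorem IsBipolarRel.trivial_or_series_or_theta [Finite V] (h : IsBipolarRel R s t) :
    (∀ x, x = s ∨ x = t) ∨ (∃ v a b, IsSeries R s t v a b) ∨
      ∃ w v p q r, IsTheta R w v p q r := by
  by_cases hf : ∃ v w, IsFork R w v
  · obtain ⟨v, hv, hvmin⟩ := (wellFounded_of_acyclic h.acyclic).has_min
      {v | ∃ w, IsFork R w v} hf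
    obtain ⟨w, hw, hwmax⟩ := (wellFounded_of_acyclic h.dual.acyclic).has_min
      {w | IsFork R w v} hv
    -- At most one branch is a single arc to `v`; name the branches so that it is not the one
    -- through `p`.
    obtain ⟨p, q, hpq, hwp, hwq, hpv, hqv⟩ : ∃ p q, p ≠ q ∧ R w p ∧ R w q ∧
        TransGen R p v ∧ ReflTransGen R q v := by
      obtain ⟨p, q, hpq, hwp, hwq, hpv, hqv⟩ := hw
      rcases reflTransGen_iff_eq_or_transGen.1 hpv with rfl | hpv'
      · exact ⟨q, v, hpq.symm, hwq, hwp,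
          (reflTransGen_iff_eq_or_transGen.1 hqv).resolve_left hpq, .refl⟩
      · exact ⟨p, q, hpq, hwp, hwq, hpv', hqv⟩
    by_cases hr : ∃ r, R p r ∧ ¬ ReflTransGen R r v
    · obtain ⟨r, hpr, hrv⟩ := hr
      exact .inr (.inr ⟨w, v, p, q, r, hwp, hwq, hpv, hqv,
        fun x hpx hqx hxv ↦ hvmin x ⟨w, p, q, hpq, hwp, hwq, hpx, hqx⟩ hxv, hpr, hrv⟩)
    -- Now `p` has degree two: a second arc in would end a fork at `p`, below `v`, and a second arc
    -- out would start a fork to `v` at `p`, above `w`.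
    · push Not at hr
      obtain ⟨y, hpy, hyv⟩ := TransGen.head'_iff.1 hpv
      refine .inr (.inl ⟨p, w, y, ?_, ?_, fun x ↦ ⟨fun hx ↦ ?_, ?_⟩, fun x ↦ ⟨fun hx ↦ ?_, ?_⟩⟩)
      · rintro rfl
        exact h.not_in w hwp
      · rintro rfl
        exact h.not_out y hpy
      · by_contra hne
        exact hvmin p (h.exists_isFork hne hx hwp) hpv
      · rintro rfl
        exact hwp
      · by_contra hne
        exact hwmax p ⟨x, y, hne, hx, hpy, hr x hx, hyv⟩ (.single hwp)
      · rintro rfl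
        exact hpy
  -- Without forks in-degrees are at most one, so every vertex other than `t` reaches the sole
  -- predecessor `v` of `t`. Either `v = s` and only the poles exist, or `v` has degree two.
  · have hin : ∀ x y z, R x z → R y z → x = y := by
      intro x y z hx hy
      by_contra hne
      exact hf ⟨z, h.exists_isFork hne hx hy⟩
    obtain ⟨v, hv⟩ := h.exists_in t h.ne.symm
    have last : ∀ x, x = t ∨ ReflTransGen R x v := by
      intro x
      rcases (h.reflTransGen_sink x).cases_tail with e | ⟨c, hxc, hc⟩
      · exact .inl e.symm
      · exact .inr (hin c v t hc hv ▸ hxc)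
    by_cases hvs : v = s
    · subst hvs
      refine .inl fun x ↦ (last x).symm.imp (fun hx ↦ ?_) id
      rcases hx.cases_tail with e | ⟨c, -, hc⟩
      exacts [e.symm, absurd hc (h.not_in c)]
    · obtain ⟨a, ha⟩ := h.exists_in v hvs
      refine .inr (.inl ⟨v, a, t, Ne.symm hvs, ?_, fun x ↦ ⟨fun hx ↦ hin x a v hx ha, ?_⟩,
        fun x ↦ ⟨fun hx ↦ (last x).resolve_right fun hxv ↦ ?_, ?_⟩⟩)
      · rintro rfl
        exact h.not_out _ hv
      · rintro rfl
        exact ha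
      · exact h.acyclic v (.head' hx hxv)
      · rintro rfl
        exact hv

/-- A bipolar relation is unique if and only if the graph with the additional edge `st` has no
`K₄` minor. -/
theorem IsBipolarRel.isUniqueBipolar_iff {V : Type*} [Finite V] {R : V → V → Prop} {s t : V}
    (h : IsBipolarRel R s t) :
    IsUniqueBipolar R s t ↔ ¬ ∃ B, IsK4Model (RootedAdj R s t) B := by
  induction hn : Nat.card V using Nat.strong_induction_on generalizing V with
  | _ n ih =>
    rcases h.trivial_or_series_or_theta with htriv | ⟨v, a, b, hv⟩ | ⟨w, v, p, q, r, hθ⟩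
    · refine iff_of_true ?_ ?_
      · intro R' hR' _ x y hxy
        rcases htriv x with rfl | rfl
        · rcases htriv y with rfl | rfl
          · exact absurd hxy (h.not_in _)
          · obtain ⟨z, hz⟩ := hR'.exists_in y h.ne.symm
            rcases htriv z with rfl | rfl
            exacts [hz, absurd hz (hR'.not_out _)]
        · exact absurd hxy (h.not_out _)
      · rintro ⟨B, hB⟩
        have key : ∀ i, s ∈ B i ∨ t ∈ B i := by
          intro i
          obtain ⟨x, hx⟩ := hB.nonempty i
          rcases htriv x with rfl | rfl
          exacts [.inl hx, .inr hx]
        have e := hB.inj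
        rcases key 0 with h0 | h0 <;> rcases key 1 with h1 | h1 <;> rcases key 2 with h2 | h2 <;>
          first
          | exact absurd (e 0 1 _ h0 h1) (by decide)
          | exact absurd (e 0 2 _ h0 h2) (by decide)
          | exact absurd (e 1 2 _ h1 h2) (by decide)
    · have hcard : Nat.card {x : V // x ≠ v} < n := by
        rw [← hn]
        exact Finite.card_subtype_lt (x := v) (by simp)
      have key := ih _ hcard (h.eliminate hv.ne_source hv.ne_sink) rfl
      constructor
      · exact fun hU hB ↦ key.1 (hv.isUniqueBipolar_eliminate h hU)
          (hv.exists_isK4Model_eliminate h hB)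
      · exact fun hB ↦ hv.isUniqueBipolar_of_eliminate h
          (key.2 fun hB' ↦ hB (hv.exists_isK4Model_of_eliminate hB'))
    · exact iff_of_false (hθ.not_isUniqueBipolar h) (not_not.2 (hθ.exists_isK4Model h))

/-! ### Existence of a bipolar relation by adding ears -/

/-- The vertices in the list `L`, other than `s` and `t`, have neighbours on both sides. -/
structure IsBipolarList (G : V → V → Prop) (s t : V) (L : List V) : Prop where
  nodup : L.Nodup
  poles : [s, t].Sublist L
  before : ∀ x ∈ L, x ≠ s → x ≠ t → ∃ y, G y x ∧ [y, x].Sublist L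
  after : ∀ x ∈ L, x ≠ s → x ≠ t → ∃ y, G x y ∧ [x, y].Sublist L

theorem List.Nodup.idxOf_lt_of_sublist [DecidableEq V] {L : List V} (h : L.Nodup) {x y : V}
    (hxy : [x, y].Sublist L) : L.idxOf x < L.idxOf y := by
  have : L.Pairwise fun a b ↦ L.idxOf a < L.idxOf b := by
    rw [List.pairwise_iff_getElem]
    intro i j hi hj hij
    rwa [h.idxOf_getElem, h.idxOf_getElem]
  exact List.pairwise_iff_forall_sublist.1 this hxy

theorem List.pair_sublist_or {L : List V} {x y : V} (hx : x ∈ L) (hy : y ∈ L) (hne : x ≠ y) :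
    (∃ L₁ L₂, L = L₁ ++ x :: L₂ ∧ y ∈ L₂) ∨ ∃ L₁ L₂, L = L₁ ++ y :: L₂ ∧ x ∈ L₂ := by
  obtain ⟨L₁, L₂, rfl⟩ := List.append_of_mem hx
  simp only [List.mem_append, List.mem_cons] at hy
  rcases hy with hy | hy | hy
  · obtain ⟨A, B, rfl⟩ := List.append_of_mem hy
    exact .inr ⟨A, B ++ x :: L₂, by simp, by simp⟩
  · exact absurd hy.symm hne
  · exact .inl ⟨L₁, L₂, rfl, hy⟩

namespace IsBipolarList

variable {G : V → V → Prop} {L : List V}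

theorem reverse (hG : ∀ x y, G x y → G y x) (h : IsBipolarList G s t L) :
    IsBipolarList G t s L.reverse := by
  have key : ∀ x y, [x, y].Sublist L → [y, x].Sublist L.reverse := by
    intro x y hxy
    simpa using hxy.reverse
  refine ⟨List.nodup_reverse.2 h.nodup, key _ _ h.poles, fun x hx hxt hxs ↦ ?_,
    fun x hx hxt hxs ↦ ?_⟩
  · obtain ⟨y, hy, hl⟩ := h.after x (List.mem_reverse.1 hx) hxs hxt
    exact ⟨y, hG _ _ hy, key _ _ hl⟩
  · obtain ⟨y, hy, hl⟩ := h.before x (List.mem_reverse.1 hx) hxs hxt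
    exact ⟨y, hG _ _ hy, key _ _ hl⟩

/-- The head of the list has nothing before it, so it is neither `t` nor a non-polar vertex; hence
it is `s`. -/
theorem not_sublist_source (h : IsBipolarList G s t L) (y : V) : ¬ [y, s].Sublist L := by
  classical
  intro hy
  cases L with
  | nil => simp at hy
  | cons f A =>
    have first : ∀ z, ¬ [z, f].Sublist (f :: A) := by
      intro z hz
      have := h.nodup.idxOf_lt_of_sublist hz
      simp at this
    have hfs : f ≠ s := by
      rintro rfl
      exact first y hy
    have hft : f ≠ t := by
      rintro rfl
      exact first s h.poles
    obtain ⟨z, -, hz⟩ := h.before f List.mem_cons_self hfs hft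
    exact first z hz

/-- Inserting an ear between two vertices of the list. -/
theorem insert_ear {L₁ L₂ l : List V} {x y : V} (h : IsBipolarList G s t (L₁ ++ x :: L₂))
    (hy : y ∈ L₂) (hl : l.Nodup) (hd : ∀ z ∈ l, z ∉ L₁ ++ x :: L₂)
    (hc : (x :: (l ++ [y])).IsChain G) : IsBipolarList G s t (L₁ ++ x :: (l ++ L₂)) := by
  have hsub : (L₁ ++ x :: L₂).Sublist (L₁ ++ x :: (l ++ L₂)) :=
    .append (.refl _) (.cons_cons x (List.sublist_append_right l L₂))
  -- The whole ear, ends included, appears in order, so each inner vertex has its two ear neighbours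
  -- on opposite sides.
  have hear : (x :: (l ++ [y])).Sublist (L₁ ++ x :: (l ++ L₂)) :=
    (List.Sublist.cons_cons x (.append (.refl l) (List.singleton_sublist.2 hy))).trans
      (List.sublist_append_right L₁ _)
  have hmem : ∀ z, z ∈ L₁ ++ x :: (l ++ L₂) → z ∈ L₁ ++ x :: L₂ ∨ z ∈ l := by
    intro z
    simp only [List.mem_append, List.mem_cons]
    tauto
  refine ⟨?_, h.poles.trans hsub, fun z hz hzs hzt ↦ ?_, fun z hz hzs hzt ↦ ?_⟩
  · have hp : (L₁ ++ x :: (l ++ L₂)).Perm (l ++ (L₁ ++ x :: L₂)) := by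
      have h1 : (x :: (l ++ L₂)).Perm (l ++ x :: L₂) := List.perm_middle.symm
      refine (h1.append_left L₁).trans ?_
      rw [← List.append_assoc, ← List.append_assoc]
      exact List.perm_append_comm.append_right _
    rw [hp.nodup_iff, List.nodup_append']
    exact ⟨hl, h.nodup, hd⟩
  · rcases hmem z hz with hz | hz
    · obtain ⟨u, hu, hl⟩ := h.before z hz hzs hzt
      exact ⟨u, hu, hl.trans hsub⟩
    · obtain ⟨A, B, rfl⟩ := List.append_of_mem hz
      have e : x :: (A ++ z :: B ++ [y]) = (x :: A) ++ z :: (B ++ [y]) := by simp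
      rw [e] at hc hear
      obtain ⟨u, C, hu⟩ : ∃ u C, x :: A = C ++ [u] :=
        ⟨_, _, (List.dropLast_append_getLast (List.cons_ne_nil x A)).symm⟩
      rw [hu, List.append_assoc, List.singleton_append] at hc hear
      have h1 := (List.isChain_append.1 hc).2.1
      refine ⟨u, (List.isChain_cons_cons.1 h1).1, .trans ?_ hear⟩
      exact .trans (.cons_cons u (.cons_cons z (List.nil_sublist _))) (List.sublist_append_right C _)
  · rcases hmem z hz with hz | hz
    · obtain ⟨u, hu, hl⟩ := h.after z hz hzs hzt
      exact ⟨u, hu, hl.trans hsub⟩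
    · obtain ⟨A, B, rfl⟩ := List.append_of_mem hz
      have e : x :: (A ++ z :: B ++ [y]) = (x :: A) ++ z :: (B ++ [y]) := by simp
      rw [e] at hc hear
      obtain ⟨u, C, hu⟩ : ∃ u C, B ++ [y] = u :: C := by
        cases B with
        | nil => exact ⟨y, [], rfl⟩
        | cons b B => exact ⟨b, B ++ [y], rfl⟩
      rw [hu] at hc hear
      have h1 := (List.isChain_append.1 hc).2.1
      refine ⟨u, (List.isChain_cons_cons.1 h1).1, .trans ?_ hear⟩
      exact .trans (.cons_cons z (.cons_cons u (List.nil_sublist _)))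
        (List.sublist_append_right (x :: A) _)

end IsBipolarList

/-- A path that starts outside of `L` and ends in `L` contains an ear. -/
theorem exists_ear {G : V → V → Prop} {L : List V} {x w e : V}
    (h : ReflTransGen (fun u z ↦ G u z ∧ z ≠ x) w e) (he : e ∈ L) (hw : w ∉ L) :
    ∃ l y, y ∈ L ∧ y ≠ x ∧ (w :: l).Nodup ∧ (∀ z ∈ w :: l, z ∉ L) ∧
      (w :: (l ++ [y])).IsChain G := by
  induction h using ReflTransGen.head_induction_on with
  | refl => exact absurd he hw
  | @head u z huz _ ih =>
    by_cases hz : z ∈ L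
    · exact ⟨[], z, hz, huz.2, by simp, by simpa using hw, by simpa using huz.1⟩
    obtain ⟨l, y, hy, hyx, hnd, hdisj, hc⟩ := ih hz
    -- If the path revisits `u`, cut out the closed part and keep the suffix from `u`.
    by_cases hu : u ∈ z :: l
    · obtain ⟨A, B, e⟩ := List.append_of_mem hu
      have hs : (u :: B).Sublist (z :: l) := e ▸ List.sublist_append_right A _
      refine ⟨B, y, hy, hyx, hs.nodup hnd, fun a ha ↦ hdisj a (hs.subset ha), ?_⟩
      rw [← List.cons_append, e, List.append_assoc] at hc
      exact (List.isChain_append.1 hc).2.1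
    · refine ⟨z :: l, y, hy, hyx, List.nodup_cons.2 ⟨hu, hnd⟩, ?_, ?_⟩
      · exact List.forall_mem_cons.2 ⟨hw, hdisj⟩
      · exact List.isChain_cons_cons.2 ⟨huz.1, hc⟩

/-- If no vertex separates another one from both poles, there is a bipolar orientation. -/
theorem exists_isBipolarRel [Finite V] {G : V → V → Prop} (hG : ∀ x y, G x y → G y x)
    (hirr : ∀ x, ¬ G x x) (hst : s ≠ t) (hs : ∃ y, G s y) (ht : ∃ y, G t y)
    (hconn : ∀ x w, ∃ e, (e = s ∨ e = t) ∧ ReflTransGen (fun u z ↦ G u z ∧ z ≠ x) w e) :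
    ∃ R, IsBipolarRel R s t ∧ ∀ x y, G x y ↔ R x y ∨ R y x := by
  classical
  obtain ⟨L, hL, hfull⟩ : ∃ L, IsBipolarList G s t L ∧ ∀ x, x ∈ L := by
    by_contra! hno
    -- If no list were complete, ears could be added forever, against finiteness.
    have grow : ∀ n, ∃ L, IsBipolarList G s t L ∧ n ≤ L.length := by
      intro n
      induction n with
      | zero =>
        refine ⟨[s, t], ⟨by simpa using hst, .refl _, ?_, ?_⟩, Nat.zero_le _⟩ <;>
          · intro x hx hxs hxt
            simp [hxs, hxt] at hx
      | succ n ih =>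
        obtain ⟨L, hL, hn⟩ := ih
        have hpole : ∀ e, e = s ∨ e = t → e ∈ L := by
          rintro e (rfl | rfl)
          exacts [hL.poles.subset (by simp), hL.poles.subset (by simp)]
        obtain ⟨w, x, hw, hx, hxw⟩ : ∃ w x, w ∉ L ∧ x ∈ L ∧ G x w := by
          obtain ⟨w, hw⟩ := hno L hL
          obtain ⟨e, he, hp⟩ := hconn s w
          have he := hpole e he
          induction hp using ReflTransGen.head_induction_on with
          | refl => exact absurd he hw
          | @head u z huz _ ih =>
            by_cases hz : z ∈ L
            exacts [⟨u, z, hw, hz, hG _ _ huz.1⟩, ih hz]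
        -- A path from `w` to a pole avoiding `x` makes the ear return to the list at some `y ≠ x`.
        -- The ear is inserted after whichever end comes first, reversed if that is `y`.
        obtain ⟨e, he, hp⟩ := hconn x w
        obtain ⟨l, y, hy, hyx, hnd, hdisj, hc⟩ := exists_ear hp (hpole e he) hw
        have hc : (x :: ((w :: l) ++ [y])).IsChain G := List.isChain_cons_cons.2 ⟨hxw, hc⟩
        rcases List.pair_sublist_or hx hy hyx.symm with ⟨L₁, L₂, rfl, hm⟩ | ⟨L₁, L₂, rfl, hm⟩
        · refine ⟨_, hL.insert_ear hm hnd hdisj hc, ?_⟩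
          simp at hn ⊢
          omega
        · have hc' : (y :: ((w :: l).reverse ++ [x])).IsChain G := by
            have := List.isChain_reverse.2 (hc.imp fun a b hab ↦ hG a b hab)
            simpa using this
          refine ⟨_, hL.insert_ear hm (List.nodup_reverse.2 hnd)
            (fun z hz ↦ hdisj z (List.mem_reverse.1 hz)) hc', ?_⟩
          simp at hn ⊢
          omega
    obtain ⟨L, hL, hn⟩ := grow (Nat.card V + 1)
    have := Fintype.ofFinite V
    have := hL.nodup.length_le_card
    rw [Nat.card_eq_fintype_card] at hn
    omega
  have hfirst := hL.not_sublist_source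
  have hlast : ∀ y, ¬ [t, y].Sublist L := by
    intro y hy
    exact (hL.reverse hG).not_sublist_source y (by simpa using hy.reverse)
  have htot : ∀ x y, x ≠ y → [x, y].Sublist L ∨ [y, x].Sublist L := by
    have key : ∀ x y (L₁ L₂ : List V), y ∈ L₂ → [x, y].Sublist (L₁ ++ x :: L₂) :=
      fun x y L₁ L₂ hy ↦ .trans (.cons_cons x (List.singleton_sublist.2 hy))
        (List.sublist_append_right L₁ _)
    intro x y hne
    rcases List.pair_sublist_or (hfull x) (hfull y) hne with ⟨L₁, L₂, e, hm⟩ | ⟨L₁, L₂, e, hm⟩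
    · exact .inl (e ▸ key _ _ _ _ hm)
    · exact .inr (e ▸ key _ _ _ _ hm)
  refine ⟨fun x y ↦ G x y ∧ [x, y].Sublist L, ⟨?_, ?_, ?_, fun y hy ↦ hfirst y hy.2,
    fun y hy ↦ hlast y hy.2, hst⟩, fun x y ↦ ⟨fun h ↦ ?_, ?_⟩⟩
  · intro x hx
    have key : ∀ x y, TransGen (fun x y ↦ G x y ∧ [x, y].Sublist L) x y →
        L.idxOf x < L.idxOf y := by
      intro x y hxy
      induction hxy with
      | single h => exact hL.nodup.idxOf_lt_of_sublist h.2
      | tail _ h ih => exact ih.trans (hL.nodup.idxOf_lt_of_sublist h.2)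
    exact lt_irrefl _ (key x x hx)
  · intro x hxs
    by_cases hxt : x = t
    · subst hxt
      obtain ⟨y, hy⟩ := ht
      have hne : x ≠ y := fun e ↦ hirr x (by rwa [← e] at hy)
      exact ⟨y, hG _ _ hy, (htot x y hne).resolve_left (hlast y)⟩
    · exact hL.before x (hfull x) hxs hxt
  · intro x hxt
    by_cases hxs : x = s
    · subst hxs
      obtain ⟨y, hy⟩ := hs
      have hne : x ≠ y := fun e ↦ hirr x (by rwa [← e] at hy)
      exact ⟨y, hy, (htot x y hne).resolve_right (hfirst y)⟩
    · exact hL.after x (hfull x) hxs hxt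
  · have hne : x ≠ y := fun e ↦ hirr x (by rwa [← e] at h)
    exact (htot x y hne).imp (fun hl ↦ ⟨h, hl⟩) fun hl ↦ ⟨hG _ _ h, hl⟩
  · exact fun h ↦ h.elim And.left fun h ↦ hG _ _ h.1

end

/-! ### From multigraphs and orientations to relations -/

theorem SimpleGraph.isMinorOf_completeGraph_iff {V : Type*} (H : SimpleGraph V) :
    (SimpleGraph.completeGraph (Fin 4)).IsMinorOf H ↔ ∃ B, IsK4Model H.Adj B := by
  have conn : ∀ B : Set V, (H.induce B).Connected ↔ B.Nonempty ∧
      ∀ x ∈ B, ∀ y ∈ B, ReflTransGen (fun u w ↦ H.Adj u w ∧ w ∈ B) x y := by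
    intro B
    rw [SimpleGraph.connected_iff, and_comm, Set.nonempty_coe_sort]
    refine and_congr_right fun _ ↦ ⟨fun h x hx y hy ↦ ?_, fun h ↦ ?_⟩
    · have := (SimpleGraph.reachable_iff_reflTransGen _ _).1 (h ⟨x, hx⟩ ⟨y, hy⟩)
      exact ReflTransGen.lift Subtype.val (fun u w huw ↦ ⟨huw, w.2⟩) _ _ this
    · rintro ⟨x, hx⟩ ⟨y, hy⟩
      have key : ∀ y (hxy : ReflTransGen (fun u w ↦ H.Adj u w ∧ w ∈ B) x y) (hy : y ∈ B),
          (H.induce B).Reachable ⟨x, hx⟩ ⟨y, hy⟩ := by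
        intro y hxy
        induction hxy with
        | refl => exact fun _ ↦ .refl _
        | @tail u w h1 h2 ih =>
          intro hw
          have hu : u ∈ B := by
            rcases h1.cases_tail with rfl | ⟨_, _, h⟩
            exacts [hx, h.2]
          exact (ih hu).trans (SimpleGraph.Adj.reachable (by simpa using h2.1))
      exact key y (h x hx y hy) hy
  constructor
  · rintro ⟨B, hB, hd, ha⟩
    refine ⟨B, fun i ↦ ((conn _).1 (hB i)).1, fun i ↦ ((conn _).1 (hB i)).2, ?_, ha⟩
    intro i j x hi hj
    by_contra hne
    exact Set.disjoint_left.1 (hd i j hne) hi hj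
  · rintro ⟨B, hB⟩
    refine ⟨B, fun i ↦ (conn _).2 ⟨hB.nonempty i, hB.connected i⟩, ?_, hB.adj⟩
    intro i j hij
    exact Set.disjoint_left.2 fun x hi hj ↦ hij (hB.inj i j x hi hj)

namespace GraphOrientation

variable {α β : Type*} {G : Graph α β}

/-- The relation on the vertices given by the arcs of an orientation. -/
def rel (O : GraphOrientation G) (x y : V(G)) : Prop := ∃ e, O.Arc e x y

/-- The orientation of a graph given by a relation on its vertices. -/
def ofRel (R : V(G) → V(G) → Prop) (hasymm : ∀ x y, R x y → ¬ R y x)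
    (hR : ∀ x y : V(G), G.Adj x y → R x y ∨ R y x) : GraphOrientation G where
  Arc e x y := G.IsLink e x y ∧ ∃ (hx : x ∈ V(G)) (hy : y ∈ V(G)), R ⟨x, hx⟩ ⟨y, hy⟩
  isLink _ _ _ h := h.1
  arc_or_arc e x y h := (hR ⟨x, h.left_mem⟩ ⟨y, h.right_mem⟩ ⟨e, h⟩).imp
    (fun h' ↦ ⟨h, _, _, h'⟩) (fun h' ↦ ⟨h.symm, _, _, h'⟩)
  arc_unique e x y x' y' h h' := by
    obtain ⟨h, hx, hy, h1⟩ := h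
    obtain ⟨h', hx', hy', h2⟩ := h'
    rcases Graph.IsLink.eq_and_eq_or_eq_and_eq h h' with e | ⟨rfl, rfl⟩
    · exact e
    · exact absurd h2 (hasymm _ _ h1)

theorem rel_ofRel {R : V(G) → V(G) → Prop} (hasymm : ∀ x y, R x y → ¬ R y x)
    (hR : ∀ x y : V(G), G.Adj x y ↔ R x y ∨ R y x) (x y : V(G)) :
    (ofRel R hasymm fun x y ↦ (hR x y).1).rel x y ↔ R x y := by
  constructor
  · rintro ⟨e, h⟩
    exact h.2.2.2
  · intro h
    obtain ⟨e, he⟩ := (hR x y).2 (.inl h)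
    exact ⟨e, he, x.2, y.2, h⟩

theorem adj_iff_rel (O : GraphOrientation G) (x y : V(G)) :
    G.Adj x y ↔ O.rel x y ∨ O.rel y x := by
  constructor
  · rintro ⟨e, he⟩
    exact (O.arc_or_arc e x y he).imp (⟨e, ·⟩) (⟨e, ·⟩)
  · rintro (⟨e, he⟩ | ⟨e, he⟩)
    exacts [⟨e, O.isLink _ _ _ he⟩, ⟨e, (O.isLink _ _ _ he).symm⟩]

/-- An orientation is bipolar if and only if its relation is. -/
theorem isBipolar_iff (O : GraphOrientation G) {s t : V(G)} (hst : s ≠ t) :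
    O.IsBipolar s t ↔ IsBipolarRel O.rel s t := by
  constructor
  · rintro ⟨hac, hs, ht⟩
    refine ⟨fun x hx ↦ hac x (TransGen.lift Subtype.val (fun _ _ h ↦ h) _ _ hx), fun x hx ↦ ?_,
      fun x hx ↦ ?_, ?_, ?_, hst⟩
    · by_contra! hno
      exact hx (Subtype.ext ((hs x).1 ⟨x.2, fun e u h ↦
        hno ⟨u, (O.isLink _ _ _ h).left_mem⟩ ⟨e, h⟩⟩))
    · by_contra! hno
      exact hx (Subtype.ext ((ht x).1 ⟨x.2, fun e u h ↦
        hno ⟨u, (O.isLink _ _ _ h).right_mem⟩ ⟨e, h⟩⟩))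
    · rintro y ⟨e, he⟩
      exact ((hs s).2 rfl).2 e y he
    · rintro y ⟨e, he⟩
      exact ((ht t).2 rfl).2 e y he
  · intro h
    refine ⟨fun x hx ↦ ?_, fun v ↦ ⟨fun hv ↦ ?_, ?_⟩, fun v ↦ ⟨fun hv ↦ ?_, ?_⟩⟩
    · have key : ∀ x y, TransGen (fun u v ↦ ∃ e, O.Arc e u v) x y →
          ∃ (hx : x ∈ V(G)) (hy : y ∈ V(G)), TransGen O.rel ⟨x, hx⟩ ⟨y, hy⟩ := by
        intro x y hxy
        induction hxy with
        | single h1 =>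
          obtain ⟨e, he⟩ := h1
          have hl := O.isLink _ _ _ he
          exact ⟨hl.left_mem, hl.right_mem, .single ⟨e, he⟩⟩
        | tail _ h2 ih =>
          obtain ⟨e, he⟩ := h2
          obtain ⟨hx, hy, h3⟩ := ih
          exact ⟨hx, (O.isLink _ _ _ he).right_mem, h3.tail ⟨e, he⟩⟩
      obtain ⟨hx', _, h'⟩ := key x x hx
      exact h.acyclic _ h'
    · by_contra hne
      obtain ⟨y, e, he⟩ := h.exists_in ⟨v, hv.1⟩ fun e ↦ hne (congrArg Subtype.val e)
      exact hv.2 e y he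
    · rintro rfl
      exact ⟨s.2, fun e u he ↦ h.not_in ⟨u, (O.isLink _ _ _ he).left_mem⟩ ⟨e, he⟩⟩
    · by_contra hne
      obtain ⟨y, e, he⟩ := h.exists_out ⟨v, hv.1⟩ fun e ↦ hne (congrArg Subtype.val e)
      exact hv.2 e y he
    · rintro rfl
      exact ⟨t.2, fun e u he ↦ h.not_out ⟨u, (O.isLink _ _ _ he).right_mem⟩ ⟨e, he⟩⟩

/-- An orientation is determined by its relation, if that relation is bipolar. -/
theorem eq_of_rel_imp {O O' : GraphOrientation G} {s t : V(G)} (hO' : IsBipolarRel O'.rel s t)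
    (h : ∀ x y, O.rel x y → O'.rel x y) : O = O' := by
  -- Parallel edges cannot be directed oppositely, so the relation fixes the direction of every
  -- edge.
  have hasymm : ∀ e x y, O'.Arc e x y → ∀ f, ¬ O'.Arc f y x := by
    intro e x y he f hf
    have hl := O'.isLink _ _ _ he
    exact hO'.asymm (x := ⟨x, hl.left_mem⟩) (y := ⟨y, hl.right_mem⟩) ⟨e, he⟩ ⟨f, hf⟩
  have key : ∀ e x y, O.Arc e x y → O'.Arc e x y := by
    intro e x y he
    have hl := O.isLink _ _ _ he
    obtain ⟨f, hf⟩ := h ⟨x, hl.left_mem⟩ ⟨y, hl.right_mem⟩ ⟨e, he⟩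
    exact (O'.arc_or_arc e x y hl).resolve_right fun h' ↦ hasymm f x y hf e h'
  ext e x y
  refine ⟨key e x y, fun he ↦ ?_⟩
  refine (O.arc_or_arc e x y (O'.isLink _ _ _ he)).resolve_right fun h' ↦ ?_
  exact hasymm e x y he e (key e y x h')

end GraphOrientation

/-! ### Non-separability of the rooted map -/

namespace BipolarMap

variable {β : Type*} (M : BipolarMap β)

/-- The source, as an element of the vertex set. -/
abbrev sourceVertex : V(M.graph) := ⟨M.source, M.source_mem⟩

/-- The sink, as an element of the vertex set. -/
abbrev sinkVertex : V(M.graph) := ⟨M.sink, M.sink_mem⟩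

theorem sourceVertex_ne_sinkVertex : M.sourceVertex ≠ M.sinkVertex :=
  fun e ↦ M.source_ne_sink (congrArg Subtype.val e)

theorem rootedGraph_adj_iff {R : V(M.graph) → V(M.graph) → Prop}
    (hR : IsBipolarRel R M.sourceVertex M.sinkVertex)
    (hadj : ∀ x y : V(M.graph), M.graph.Adj x y ↔ R x y ∨ R y x) (x y : V(M.graph)) :
    M.rootedGraph.toSimpleGraph.Adj x y ↔ RootedAdj R M.sourceVertex M.sinkVertex x y := by
  have h1 : M.rootedGraph.Adj x y ↔ RootedAdj R M.sourceVertex M.sinkVertex x y := by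
    rw [RootedAdj, ← or_assoc, ← hadj]
    constructor
    · rintro ⟨_ | e, he⟩
      · exact .inr (he.imp (And.imp Subtype.ext Subtype.ext) (And.imp Subtype.ext Subtype.ext))
      · exact .inl ⟨e, he⟩
    · rintro (⟨e, he⟩ | he)
      · exact ⟨some e, he⟩
      · exact ⟨none, he.imp (And.imp (congrArg _) (congrArg _)) (And.imp (congrArg _) (congrArg _))⟩
  -- Adjacency in the simple graph also asks for distinct ends; acyclicity and distinctness of the
  -- poles provide this.
  refine ⟨fun h ↦ h1.1 h.2, fun h ↦ ⟨?_, h1.2 h⟩⟩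
  rintro rfl
  rcases h with h | h | ⟨rfl, h⟩ | ⟨rfl, h⟩
  exacts [hR.asymm h h, hR.asymm h h, M.sourceVertex_ne_sinkVertex h,
    M.sourceVertex_ne_sinkVertex h.symm]

/-- A map with a bipolar orientation is non-separable once the root edge is added. -/
theorem not_isSeparable [Finite V(M.graph)] (O : GraphOrientation M.graph)
    (hR : IsBipolarRel O.rel M.sourceVertex M.sinkVertex) : ¬ M.rootedGraph.IsSeparable := by
  rintro ⟨v, -, A, B, hA, hB, hAB, hE, hsep⟩
  wlog hroot : none ∈ A generalizing A B
  · refine this B A hB hA hAB.symm (Set.union_comm A B ▸ hE)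
      (fun e he f hf w hw hw' ↦ hsep f hf e he w hw' hw) ?_
    have : none ∈ A ∪ B := by
      rw [hE]
      exact (show M.rootedGraph.IsLink none M.source M.sink from .inl ⟨rfl, rfl⟩).edge_mem
    exact this.resolve_left hroot
  -- Away from the cut vertex, a single edge of `B` forces all edges at that vertex into `B`; a pole
  -- other than `v` thus has no edge of `B`.
  have incB : ∀ e ∈ B, ∀ w, w ≠ v → M.rootedGraph.Inc e w → ∀ f, M.rootedGraph.Inc f w →
      f ∈ B := by
    intro e he w hw hew f hfw
    have : f ∈ A ∪ B := hE ▸ hfw.edge_mem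
    exact this.resolve_left fun hf ↦ hw (hsep f hf e he w hfw hew)
  have hnone : none ∉ B := Set.disjoint_left.1 hAB hroot
  have incs : M.rootedGraph.Inc none M.source := ⟨M.sink, .inl ⟨rfl, rfl⟩⟩
  have inct : M.rootedGraph.Inc none M.sink := ⟨M.source, .inr ⟨rfl, rfl⟩⟩
  have inc_left : ∀ {e} {x y : V(M.graph)}, O.Arc e x y → M.rootedGraph.Inc (some e) x :=
    fun {e x y} h ↦ ⟨y, O.isLink _ _ _ h⟩
  have inc_right : ∀ {e} {x y : V(M.graph)}, O.Arc e x y → M.rootedGraph.Inc (some e) y :=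
    fun {e x y} h ↦ ⟨x, (O.isLink _ _ _ h).symm⟩
  -- An edge of `B` at `x` is followed upwards to the sink, or to the cut vertex.
  have up : ∀ x : V(M.graph), (∃ e ∈ B, M.rootedGraph.Inc e x) →
      ∃ hv : v ∈ V(M.graph), ReflTransGen O.rel x ⟨v, hv⟩ := by
    intro x
    have hx := hR.reflTransGen_sink x
    induction hx using ReflTransGen.head_induction_on with
    | refl =>
      rintro ⟨e, he, hi⟩
      by_cases hv : M.sink = v
      · subst hv
        exact ⟨M.sink_mem, .refl⟩
      · exact absurd (incB e he _ hv hi none inct) hnone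
    | @head x y hxy _ ih =>
      rintro ⟨e, he, hi⟩
      by_cases hv : x.1 = v
      · subst hv
        exact ⟨x.2, .refl⟩
      · have hxy' := hxy
        obtain ⟨f, hf⟩ := hxy
        obtain ⟨hv, hyv⟩ := ih ⟨some f, incB e he _ hv hi _ (inc_left hf), inc_right hf⟩
        exact ⟨hv, .head hxy' hyv⟩
  have down : ∀ x : V(M.graph), (∃ e ∈ B, M.rootedGraph.Inc e x) →
      ∃ hv : v ∈ V(M.graph), ReflTransGen O.rel ⟨v, hv⟩ x := by
    intro x
    have hx := hR.reflTransGen_source x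
    induction hx with
    | refl =>
      rintro ⟨e, he, hi⟩
      by_cases hv : M.source = v
      · subst hv
        exact ⟨M.source_mem, .refl⟩
      · exact absurd (incB e he _ hv hi none incs) hnone
    | @tail y x _ hyx ih =>
      rintro ⟨e, he, hi⟩
      by_cases hv : x.1 = v
      · subst hv
        exact ⟨x.2, .refl⟩
      · have hyx' := hyx
        obtain ⟨f, hf⟩ := hyx
        obtain ⟨hv, hvy⟩ := ih ⟨some f, incB e he _ hv hi _ (inc_right hf), inc_left hf⟩
        exact ⟨hv, .tail hvy hyx'⟩
  obtain ⟨f, hf⟩ := hB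
  rcases f with _ | f
  · exact hnone hf
  have hfE : some f ∈ E(M.rootedGraph) := hE ▸ Set.mem_union_right A hf
  obtain ⟨a, b, hab⟩ := M.rootedGraph.exists_isLink_of_mem_edgeSet hfE
  obtain ⟨x, y, hxy⟩ : ∃ x y : V(M.graph), O.Arc f x y := by
    have hab : M.graph.IsLink f a b := hab
    rcases O.arc_or_arc f a b hab with h | h
    exacts [⟨⟨a, hab.left_mem⟩, ⟨b, hab.right_mem⟩, h⟩, ⟨⟨b, hab.right_mem⟩, ⟨a, hab.left_mem⟩, h⟩]
  obtain ⟨hv, hvx⟩ := down x ⟨some f, hf, inc_left hxy⟩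
  obtain ⟨_, hyv⟩ := up y ⟨some f, hf, inc_right hxy⟩
  exact hR.acyclic x (.trans_left (.head' ⟨f, hxy⟩ hyv) hvx)

theorem exists_adj (x : V(M.graph)) : ∃ y : V(M.graph), M.graph.Adj x y := by
  have : Nontrivial V(M.graph) := ⟨_, _, M.sourceVertex_ne_sinkVertex⟩
  obtain ⟨y, hy⟩ := M.connected.preconnected.exists_adj_of_nontrivial x
  exact ⟨y, hy.2⟩

/-- A loop could be separated, as a class of its own, from the other edges, among which is the root
edge. -/
theorem not_adj_self (h : ¬ M.rootedGraph.IsSeparable) (x : V(M.graph)) :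
    ¬ M.graph.Adj x x := by
  rintro ⟨e, he⟩
  have he' : M.rootedGraph.IsLink (some e) x x := he
  refine h ⟨x, x.2, {some e}, E(M.rootedGraph) \ {some e}, Set.singleton_nonempty _, ⟨none, ?_⟩,
    Set.disjoint_sdiff_right, ?_, ?_⟩
  · have : M.rootedGraph.IsLink none M.source M.sink := .inl ⟨rfl, rfl⟩
    exact ⟨this.edge_mem, by simp⟩
  · rw [Set.union_sdiff_self]
    exact Set.union_eq_right.2 (Set.singleton_subset_iff.2 he'.edge_mem)
  · rintro _ rfl f - w hw -
    exact (hw.eq_or_eq_of_isLink he').elim id id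

/-- In a non-separable rooted map, no vertex separates another one from both poles. -/
theorem exists_reflTransGen_pole (h : ¬ M.rootedGraph.IsSeparable) (x w : V(M.graph)) :
    ∃ e, (e = M.sourceVertex ∨ e = M.sinkVertex) ∧
      ReflTransGen (fun u z : V(M.graph) ↦ M.graph.Adj u z ∧ z ≠ x) w e := by
  by_contra! hno
  -- The edges that meet `C` are separated from the rest at `x`. If `C` misses both poles, the root
  -- edge is in the other class.
  let C : Set V(M.graph) :=
    {z | ReflTransGen (fun u z : V(M.graph) ↦ M.graph.Adj u z ∧ z ≠ x) w z}
  let A : Set (Option β) := {e | ∃ c ∈ C, M.rootedGraph.Inc e c}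
  refine h ⟨x, x.2, A, E(M.rootedGraph) \ A, ?_, ⟨none, ?_, ?_⟩, Set.disjoint_sdiff_right, ?_, ?_⟩
  · obtain ⟨y, e, he⟩ := M.exists_adj w
    exact ⟨some e, w, .refl, y, he⟩
  · have : M.rootedGraph.IsLink none M.source M.sink := .inl ⟨rfl, rfl⟩
    exact this.edge_mem
  · rintro ⟨c, hc, y, ⟨hcs, -⟩ | ⟨hct, -⟩⟩
    · exact hno c (.inl (Subtype.ext hcs)) hc
    · exact hno c (.inr (Subtype.ext hct)) hc
  · rw [Set.union_sdiff_self]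
    refine Set.union_eq_right.2 ?_
    rintro e ⟨c, -, hc⟩
    exact hc.edge_mem
  -- A shared vertex other than `x` is reached from `c` along `e` or equals `c`, so it lies in `C`,
  -- and then `f` meets `C` as well.
  · rintro e ⟨c, hc, d, hcd⟩ f ⟨-, hf⟩ z hez hfz
    by_contra hzx
    refine hf ⟨⟨z, hfz.vertex_mem⟩, ?_, hfz⟩
    rcases hez.eq_or_eq_of_isLink hcd with rfl | rfl
    · exact hc
    rcases e with _ | e
    · rcases hcd with ⟨hcs, -⟩ | ⟨hct, -⟩
      · exact absurd hc (hno c (.inl (Subtype.ext hcs)))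
      · exact absurd hc (hno c (.inr (Subtype.ext hct)))
    · exact ReflTransGen.tail hc ⟨⟨e, hcd⟩, fun e ↦ hzx (congrArg Subtype.val e)⟩

/-- A map that is non-separable once the root edge is added has a bipolar orientation. -/
theorem exists_isBipolar [Finite V(M.graph)] (h : ¬ M.rootedGraph.IsSeparable) :
    ∃ O : GraphOrientation M.graph, IsBipolarRel O.rel M.sourceVertex M.sinkVertex := by
  obtain ⟨R, hR, hadj⟩ := exists_isBipolarRel (G := fun x y : V(M.graph) ↦ M.graph.Adj x y)
    (fun _ _ ↦ Graph.Adj.symm) (M.not_adj_self h) M.sourceVertex_ne_sinkVertex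
    (M.exists_adj _) (M.exists_adj _) (M.exists_reflTransGen_pole h)
  refine ⟨.ofRel R (fun _ _ ↦ hR.asymm) fun x y ↦ (hadj x y).1, ?_⟩
  have : (GraphOrientation.ofRel R (fun _ _ ↦ hR.asymm) fun x y ↦ (hadj x y).1).rel = R := by
    ext x y
    exact GraphOrientation.rel_ofRel _ hadj x y
  rwa [this]

/-- A bipolar orientation is unique if and only if its relation is. -/
theorem forall_isBipolar_eq_iff (O : GraphOrientation M.graph) :
    (∀ O' : GraphOrientation M.graph, O'.IsBipolar M.source M.sink → O' = O) ↔
      IsUniqueBipolar O.rel M.sourceVertex M.sinkVertex := by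
  have bip := fun O' : GraphOrientation M.graph ↦ O'.isBipolar_iff M.sourceVertex_ne_sinkVertex
  constructor
  · intro hO R' hR' hs x y hxy
    have hadj : ∀ x y : V(M.graph), M.graph.Adj x y ↔ R' x y ∨ R' y x :=
      fun x y ↦ (O.adj_iff_rel x y).trans (hs x y).symm
    have hrel := GraphOrientation.rel_ofRel (fun _ _ ↦ hR'.asymm) hadj
    have := hO (.ofRel R' (fun _ _ ↦ hR'.asymm) fun x y ↦ (hadj x y).1) ((bip _).2 (by
      convert hR' using 1
      ext x y
      exact hrel x y))
    rwa [← hrel, this]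
  · intro hU O' hO'
    have hO' := (bip O').1 hO'
    exact (GraphOrientation.eq_of_rel_imp hO' (hU O'.rel hO' fun x y ↦
      (O'.adj_iff_rel x y).symm.trans (O.adj_iff_rel x y))).symm

theorem isMinorOf_rootedGraph_iff {R : V(M.graph) → V(M.graph) → Prop}
    (hR : IsBipolarRel R M.sourceVertex M.sinkVertex)
    (hadj : ∀ x y : V(M.graph), M.graph.Adj x y ↔ R x y ∨ R y x) :
    (SimpleGraph.completeGraph (Fin 4)).IsMinorOf M.rootedGraph.toSimpleGraph ↔
      ∃ B, IsK4Model (RootedAdj R M.sourceVertex M.sinkVertex) B := by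
  have : M.rootedGraph.toSimpleGraph.Adj = RootedAdj R M.sourceVertex M.sinkVertex := by
    ext x y
    exact M.rootedGraph_adj_iff hR hadj x y
  rw [SimpleGraph.isMinorOf_completeGraph_iff, this]
  rfl

end BipolarMap

/-! ### The theorem -/

/-- A bipolar planar map admits a unique bipolar orientation if and only if it is
series-parallel. -/
theorem mainTheorem9 {β : Type*} (M : BipolarMap β) :
    (∃! O : GraphOrientation M.graph, O.IsBipolar M.source M.sink) ↔ M.IsSeriesParallel := by
  have : Finite V(M.graph) := M.finite_vertexSet
  have bip := fun O : GraphOrientation M.graph ↦ O.isBipolar_iff M.sourceVertex_ne_sinkVertex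
  have key : ∀ O : GraphOrientation M.graph, IsBipolarRel O.rel M.sourceVertex M.sinkVertex →
      ((∀ O' : GraphOrientation M.graph, O'.IsBipolar M.source M.sink → O' = O) ↔
        ¬ (SimpleGraph.completeGraph (Fin 4)).IsMinorOf M.rootedGraph.toSimpleGraph) :=
    fun O hR ↦ by rw [M.forall_isBipolar_eq_iff O, hR.isUniqueBipolar_iff,
      M.isMinorOf_rootedGraph_iff hR O.adj_iff_rel]
  constructor
  · rintro ⟨O, hO, huniq⟩
    have hR := (bip O).1 hO
    exact ⟨M.not_isSeparable O hR, (key O hR).1 huniq⟩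
  · rintro ⟨hsep, hminor⟩
    obtain ⟨O, hR⟩ := M.exists_isBipolar hsep
    exact ⟨O, (bip O).2 hR, (key O hR).2 hminor⟩
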